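/- **Setting.** Let $E$ be a Lusin topological space (a homeomorph of a Borel subset of a compact metric space), $B(E)^+$ the set of bounded non-negative Borel functions on $E$, $C(E)^+$ the set of continuous functions in $B(E)^+$, and $M(E)$ the space of finite Borel measures on $E$ with the topology of weak convergence and its Borel $\sigma$-algebra. For $f\in B(E)^+$ and $\mu\in M(E)$ put $\mu(f)=\int_E f\,d\mu$, and for a probability measure $F$ on $M(E)$ let $L_F(f)=\int_{M(E)}e^{-\nu(f)}\,F(d\nu)$. Let $(Q_{r,t})_{r\le t}$, $r,t\in\mathbb R$, be the transition semigroup of a measure-valued branching process (MB-process). That is, the $Q_{r,t}$ are Markov kernels on $M(E)$ with $Q_{r,r}(\mu,\cdot)=\delta_\mu$ and $Q_{r,s}Q_{s,t}=Q_{r,t}$ for $r\le s\le t$ and, with $$V_{r,t}f(x):=-\log\int_{M(E)}e^{-\nu(f)}\,Q_{r,t}(\delta_x,d\nu),$$ the following hold: - $\int_{M(E)}e^{-\nu(f)}\,Q_{r,t}(\mu,d\nu)=\exp\{-\mu(V_{r,t}f)\}$ for all $r\le t$, $\mu\in M(E)$, $f\in B(E)^+$; - for all $r\le t$ and $f\in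 B(E)^+$ the function $(s,x)\mapsto V_{s,t}f(x)$ is bounded and measurable on $[r,t]\times E$; - for all $r\in\mathbb R$, $x\in E$ and $f\in C(E)^+$ the function $t\mapsto V_{r,t}f(x)$ is right continuous on $[r,\infty)$. A family of probability measures $(N_{r,t})_{r\le t}$ on $M(E)$ is called a *skew convolution semigroup* associated with $(Q_{r,t})_{r\le t}$ if $N_{r,t}=(N_{r,s}Q_{s,t})*N_{s,t}$ for all $r\le s\le t$. For $s\in\mathbb R$, a *probability entrance law* at $s$ is a family $(K_{s,t})_{t>s}$ of probability measures on $M(E)$ with $K_{s,r}Q_{r,t}=K_{s,t}$ for $t>r>s$. It is *infinitely divisible* if every $K_{s,t}$ is infinitely divisible. A *closed probability entrance law* at $s$ is a family $(K_{s,t})_{t\ge s}$ of probability measures such that $(K_{s,t})_{t>s}$ is a probability entrance law and $K_{s,t}=K_{s,s}Q_{s,t}$ for all $t>s$. **Theorem 3.1.** A family of probability measures $(N_{r,t})_{r\le t}$ on $M(E)$ is a skew convolution semigroup associated with $(Q_{r,t})_{r\le t}$ if and only if there are countable sets $T_1,T_2\subset\mathbb R$, a diffuse Radon measure $\zeta$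 on $\mathbb R$, probability entrance laws $(K^1_{s,t})_{t>s}$ for $s\in T_1$, closed probability entrance laws $(K^2_{s,t})_{t\ge s}$ for $s\in T_2$, and infinitely divisible probability entrance laws $(K^3_{s,t})_{t>s}$ for $s\in\mathbb R$ such that, for all $r\le t$ and $f\in B(E)^+$, $$\log L_{N_{r,t}}(f)=\sum_{s\in[r,t)\cap T_1}\log L_{K^1_{s,t}}(f)+\sum_{s\in(r,t]\cap T_2}\log L_{K^2_{s,t}}(f)+\int_{(r,t)}\log L_{K^3_{s,t}}(f)\,\zeta(ds),$$ where both sums converge absolutely and the integrand $s\mapsto\log L_{K^3_{s,t}}(f)$ is $\zeta$-integrable on $(r,t)$. -/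

import Mathlib

open MeasureTheory ProbabilityTheory
open scoped MeasureTheory ProbabilityTheory

namespace MBProcess

universe u

/-- A Lusin topological space: a homeomorph of a Borel subset of a compact metric space. -/
class LusinTopologicalSpace (E : Type u) [TopologicalSpace E] : Prop where
  exists_embedding : ∃ (X : Type u) (_ : MetricSpace X) (_ : CompactSpace X) (φ : E → X),
    Topology.IsEmbedding φ ∧ MeasurableSet[borel X] (Set.range φ)

section Basic

variable {E : Type u} [MeasurableSpace E]

/-- `IsBPos f` says that `f` belongs to `B(E)⁺`: it is bounded, measurable and non-negative. -/
def IsBPos (f : E → ℝ) : Prop :=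
  Measurable f ∧ (∀ x, 0 ≤ f x) ∧ ∃ C : ℝ, ∀ x, f x ≤ C

/-- The Laplace functional `L_F(f) = ∫ exp(-ν(f)) F(dν)` of a measure `F` on the space `M(E)` of
finite measures on `E`. Mathlib's `σ`-algebra on `FiniteMeasure E` is the one generated by the
evaluations `ν ↦ ν(A)`, which for a Lusin space `E` is the Borel `σ`-algebra of the topology of
weak convergence. -/
noncomputable def laplace (F : Measure (FiniteMeasure E)) (f : E → ℝ) : ℝ :=
  ∫ ν, Real.exp (-∫ x, f x ∂(ν : Measure E)) ∂F

/-- The point mass at `x`, as an element of `M(E)`. -/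
noncomputable def pointMass (x : E) : FiniteMeasure E := ⟨Measure.dirac x, inferInstance⟩

/-- `V_{r,t} f (x) = -log ∫ exp(-ν(f)) Q_{r,t}(δ_x, dν)`. -/
noncomputable def cumulant (Q : ℝ → ℝ → Kernel (FiniteMeasure E) (FiniteMeasure E))
    (r t : ℝ) (f : E → ℝ) (x : E) : ℝ :=
  -Real.log (laplace (Q r t (pointMass x)) f)

/-- An inhomogeneous Markov transition semigroup `(Q_{r,t})_{r ≤ t}` on `M(E)`.
Only the values `Q r t` with `r ≤ t` matter. -/
structure IsTransitionSemigroup (Q : ℝ → ℝ → Kernel (FiniteMeasure E) (FiniteMeasure E)) :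
    Prop where
  markov : ∀ r t, r ≤ t → IsMarkovKernel (Q r t)
  refl : ∀ r, Q r r = Kernel.id
  chapman_kolmogorov : ∀ r s t, r ≤ s → s ≤ t → Q s t ∘ₖ Q r s = Q r t

/-- The transition semigroup of a measure-valued branching process, with the standing regularity
assumptions on its cumulant semigroup. -/
structure IsMBSemigroup [TopologicalSpace E]
    (Q : ℝ → ℝ → Kernel (FiniteMeasure E) (FiniteMeasure E)) : Prop
    extends IsTransitionSemigroup Q where
  /-- `(s, x) ↦ V_{s,t} f (x)` is measurable on `[r,t] × E`. -/
  measurable_cumulant : ∀ r t, r ≤ t → ∀ f : E → ℝ, IsBPos f →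
    Measurable (fun p : Set.Icc r t × E => cumulant Q p.1 t f p.2)
  /-- `(s, x) ↦ V_{s,t} f (x)` is bounded on `[r,t] × E`. -/
  bounded_cumulant : ∀ r t, r ≤ t → ∀ f : E → ℝ, IsBPos f →
    ∃ C : ℝ, ∀ s ∈ Set.Icc r t, ∀ x, |cumulant Q s t f x| ≤ C
  /-- `t ↦ V_{r,t} f (x)` is right continuous on `[r, ∞)` for `f ∈ C(E)⁺`. -/
  right_continuous_cumulant : ∀ f : E → ℝ, IsBPos f → Continuous f → ∀ r t, r ≤ t → ∀ x,
    ContinuousWithinAt (fun u => cumulant Q r u f x) (Set.Ici t) t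
  /-- The branching property `∫ exp(-ν(f)) Q_{r,t}(μ, dν) = exp(-μ(V_{r,t} f))`. -/
  branching : ∀ r t, r ≤ t → ∀ (μ : FiniteMeasure E) (f : E → ℝ), IsBPos f →
    laplace (Q r t μ) f = Real.exp (-∫ x, cumulant Q r t f x ∂(μ : Measure E))

/-- Addition on `M(E)` is measurable, so that the convolution `∗` of measures on `M(E)` is the law
of the sum of independent random measures. -/
instance instMeasurableAddFiniteMeasure : MeasurableAdd₂ (FiniteMeasure E) where
  measurable_add := by
    refine Measurable.subtype_mk (f := fun p : FiniteMeasure E × FiniteMeasure E =>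
      (p.1 : Measure E) + (p.2 : Measure E)) ?_
    exact (measurable_subtype_coe.comp measurable_fst).add
      (measurable_subtype_coe.comp measurable_snd)

/-- The skew convolution equation `N_{r,t} = (N_{r,s} Q_{s,t}) ∗ N_{s,t}` for `r ≤ s ≤ t`. -/
def IsSCSemigroup (Q : ℝ → ℝ → Kernel (FiniteMeasure E) (FiniteMeasure E))
    (N : ℝ → ℝ → Measure (FiniteMeasure E)) : Prop :=
  ∀ r s t, r ≤ s → s ≤ t → N r t = (Q s t ∘ₘ N r s) ∗ N s t

/-- `(K_t)_{t > α}` is a probability entrance law at `α` for `(Q_{r,t})_{r ≤ t}`. -/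
structure IsProbEntranceLaw (Q : ℝ → ℝ → Kernel (FiniteMeasure E) (FiniteMeasure E))
    (α : ℝ) (K : ℝ → Measure (FiniteMeasure E)) : Prop where
  prob : ∀ t, α < t → IsProbabilityMeasure (K t)
  entrance : ∀ r t, α < r → r < t → Q r t ∘ₘ K r = K t

/-- `(K_t)_{t ≥ α}` is a closed probability entrance law at `α`: the family `(K_t)_{t > α}` is a
probability entrance law, and it is started from the probability measure `K_α`. -/
structure IsClosedProbEntranceLaw (Q : ℝ → ℝ → Kernel (FiniteMeasure E) (FiniteMeasure E))
    (α : ℝ) (K : ℝ → Measure (FiniteMeasure E)) : Prop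
    extends IsProbEntranceLaw Q α K where
  prob_initial : IsProbabilityMeasure (K α)
  closed : ∀ t, α < t → K t = Q α t ∘ₘ K α

/-- The `n`-fold convolution power of a measure on `M(E)`. -/
noncomputable def convPow (ρ : Measure (FiniteMeasure E)) : ℕ → Measure (FiniteMeasure E)
  | 0 => Measure.dirac 0
  | n + 1 => convPow ρ n ∗ ρ

/-- Infinite divisibility of a probability measure on `M(E)`: it has convolution roots of every
order among the probability measures on `M(E)`. -/
def IsInfDiv (F : Measure (FiniteMeasure E)) : Prop :=
  ∀ n : ℕ, 1 ≤ n → ∃ ρ : Measure (FiniteMeasure E), IsProbabilityMeasure ρ ∧ F = convPow ρ n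

/-- An infinitely divisible probability entrance law. -/
structure IsInfDivProbEntranceLaw (Q : ℝ → ℝ → Kernel (FiniteMeasure E) (FiniteMeasure E))
    (α : ℝ) (K : ℝ → Measure (FiniteMeasure E)) : Prop
    extends IsProbEntranceLaw Q α K where
  infDiv : ∀ t, α < t → IsInfDiv (K t)

end Basic

end MBProcess

open MBProcess

/-!
The logarithm of the Laplace functional turns the skew convolution equation into additivity: for
fixed `t` and `f`, the function `r ↦ log L_{N_{r,t}}(f)` on `(-∞, t]` has increments
`-log L_{N_{r,s}}(V_{s,t} f) ≥ 0` over `[r, s]`, so it is monotone (`IsProbSC.monotone_scFun`), and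
the semigroup property of the cumulants says that the increments before time `s` for the pair
`(t, f)` are the increments for the pair `(s, V_{s,t} f)` (`IsProbSC.scFun_eq_add`). The theorem is
the decomposition of these monotone functions, simultaneously in `t` and `f`, into right jumps, left
jumps and a diffuse part.

* Jumps. A right jump at `s` is the Laplace exponent of the limit of `N_{s,u} Q_{u,t}` as `u ↓ s`,
  and a left jump that of the limit of `N_{u,s}` as `u ↑ s`; the consistency of the increments makes
  these limits entrance laws (`IsProbSC.exists_entranceLaw`, `IsProbSC.exists_closedEntranceLaw`).
  Since every `f` is bounded, all increments are dominated by multiples of those for the test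
  function `1`, and right continuity of the cumulants at the left jumps reduces all times to
  rational ones; hence all the functions jump inside one countable set (`jumpSet`,
  `IsProbSC.continuousAt_scFun`).

* Diffuse part. By the same domination, all the diffuse measures of increments are absolutely
  continuous with respect to a single diffuse measure `ζ` (`driftMeasure`,
  `IsProbSC.restrict_absolutelyContinuous`). By differentiation of measures, the density at almost
  every `s` is the limit of `ζ[s-r,s+r]⁻¹` times the Laplace exponent of `N_{s-r,s+r} Q_{s+r,t}`,
  which is a limit of exponents of convolution powers. The same holds for every fraction of the
  density, so the density is the exponent of an infinitely divisible law
  (`IsProbSC.isLaplaceLimit_scDensity`, `IsProbSC.exists_infDivEntranceLaw`).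

In each case a functional that is a pointwise limit of Laplace functionals has to be recognized as
the Laplace functional of a probability measure on `M(E)`, in the last case for almost every `s`
only, with an exceptional null set that depends on `f`. This is `IsLaplaceLimit.exists_laplace_eq`:
`E` is embedded in a compact metric space `X`, where sets of measures of bounded mass are compact,
and Prokhorov's theorem, applied in a sequence space that contains `M(X)`, gives the limit law from
countably many test functions; the identity then extends to all Borel functions by bounded pointwise
limits, which also shows that the limit law is carried by measures on `E`.

Conversely, the three terms of the formula are additive over `[r, s]` and `[s, t]` and the entrance
law property moves the first piece from time `t` to time `s`, so the skew convolution equation holds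
for the Laplace functionals, which determine the laws (`laplace_ext`).
-/

open Filter Topology
open scoped ENNReal NNReal BoundedContinuousFunction

namespace MBProcess

universe u

section Laplace

variable {E : Type u} [MeasurableSpace E]

/-! ### Laplace functionals of random measures -/

lemma IsBPos.const {c : ℝ} (hc : 0 ≤ c) : IsBPos (fun _ : E => c) :=
  ⟨measurable_const, fun _ => hc, c, fun _ => le_rfl⟩

lemma IsBPos.add {f g : E → ℝ} (hf : IsBPos f) (hg : IsBPos g) : IsBPos (fun x => f x + g x) := by
  obtain ⟨hfm, hf0, C, hC⟩ := hf
  obtain ⟨hgm, hg0, D, hD⟩ := hg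
  exact ⟨hfm.add hgm, fun x => add_nonneg (hf0 x) (hg0 x), C + D, fun x => add_le_add (hC x) (hD x)⟩

lemma IsBPos.const_mul {f : E → ℝ} (hf : IsBPos f) {c : ℝ} (hc : 0 ≤ c) :
    IsBPos (fun x => c * f x) := by
  obtain ⟨hfm, hf0, C, hC⟩ := hf
  exact ⟨hfm.const_mul c, fun x => mul_nonneg hc (hf0 x), c * C,
    fun x => mul_le_mul_of_nonneg_left (hC x) hc⟩

lemma IsBPos.abs_sub {f g : E → ℝ} (hf : IsBPos f) (hg : IsBPos g) :
    IsBPos (fun x => |f x - g x|) := by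
  obtain ⟨hfm, hf0, C, hC⟩ := hf
  obtain ⟨hgm, hg0, D, hD⟩ := hg
  refine ⟨(hfm.sub hgm).abs, fun x => abs_nonneg _, C + D, fun x => ?_⟩
  rw [abs_le]
  constructor <;> linarith [hf0 x, hg0 x, hC x, hD x]

lemma IsBPos.indicator_one {A : Set E} (hA : MeasurableSet A) :
    IsBPos (A.indicator (fun _ => (1 : ℝ))) :=
  ⟨measurable_const.indicator hA, fun x => Set.indicator_nonneg (fun _ _ => zero_le_one) x, 1,
    fun x => Set.indicator_le_self' (fun _ _ => zero_le_one) x⟩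

lemma IsBPos.comp {E' : Type*} [MeasurableSpace E'] {f : E' → ℝ} (hf : IsBPos f) {φ : E → E'}
    (hφ : Measurable φ) : IsBPos (fun x => f (φ x)) := by
  obtain ⟨hfm, hf0, C, hC⟩ := hf
  exact ⟨hfm.comp hφ, fun x => hf0 _, C, fun x => hC _⟩

lemma IsBPos.exists_nat_bound {f : E → ℝ} (hf : IsBPos f) : ∃ n : ℕ, 1 ≤ n ∧ ∀ x, f x ≤ n := by
  obtain ⟨-, -, C, hC⟩ := hf
  obtain ⟨n, hn⟩ := exists_nat_ge C
  exact ⟨n + 1, by omega, fun x => (hC x).trans (hn.trans (by push_cast; linarith))⟩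

lemma IsBPos.integrable {f : E → ℝ} (hf : IsBPos f) (ν : Measure E) [IsFiniteMeasure ν] :
    Integrable f ν := by
  obtain ⟨hfm, hf0, C, hC⟩ := hf
  refine Integrable.of_bound hfm.aestronglyMeasurable C (ae_of_all _ fun x => ?_)
  rw [Real.norm_of_nonneg (hf0 x)]
  exact hC x

lemma IsBPos.integral_nonneg {f : E → ℝ} (hf : IsBPos f) (ν : Measure E) : 0 ≤ ∫ x, f x ∂ν :=
  MeasureTheory.integral_nonneg hf.2.1

lemma measurable_integral_finiteMeasure {f : E → ℝ} (hf : IsBPos f) :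
    Measurable fun ν : FiniteMeasure E => ∫ x, f x ∂(ν : Measure E) := by
  have h : (fun ν : FiniteMeasure E => ∫ x, f x ∂(ν : Measure E)) =
      fun ν : FiniteMeasure E => (∫⁻ x, ENNReal.ofReal (f x) ∂(ν : Measure E)).toReal := by
    funext ν
    exact integral_eq_lintegral_of_nonneg_ae (ae_of_all _ hf.2.1) hf.1.aestronglyMeasurable
  rw [h]
  exact ((Measure.measurable_lintegral hf.1.ennreal_ofReal).comp
    measurable_subtype_coe).ennreal_toReal

lemma measurable_exp_neg_integral {f : E → ℝ} (hf : IsBPos f) :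
    Measurable fun ν : FiniteMeasure E => Real.exp (-∫ x, f x ∂(ν : Measure E)) :=
  Real.measurable_exp.comp (measurable_integral_finiteMeasure hf).neg

lemma exp_neg_integral_le_one {f : E → ℝ} (hf : IsBPos f) (ν : FiniteMeasure E) :
    Real.exp (-∫ x, f x ∂(ν : Measure E)) ≤ 1 :=
  Real.exp_le_one_iff.2 (neg_nonpos.2 (hf.integral_nonneg _))

lemma integrable_exp_neg_integral {f : E → ℝ} (hf : IsBPos f) (F : Measure (FiniteMeasure E))
    [IsFiniteMeasure F] :
    Integrable (fun ν : FiniteMeasure E => Real.exp (-∫ x, f x ∂(ν : Measure E))) F := by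
  refine Integrable.of_bound (measurable_exp_neg_integral hf).aestronglyMeasurable 1
    (ae_of_all _ fun ν => ?_)
  rw [Real.norm_of_nonneg (Real.exp_pos _).le]
  exact exp_neg_integral_le_one hf ν

variable {F G : Measure (FiniteMeasure E)} {f g : E → ℝ}

lemma laplace_pos [IsProbabilityMeasure F] (hf : IsBPos f) : 0 < laplace F f :=
  integral_exp_pos (integrable_exp_neg_integral hf F)

lemma laplace_le_one [IsProbabilityMeasure F] (hf : IsBPos f) : laplace F f ≤ 1 := by
  have h := integral_mono (integrable_exp_neg_integral hf F) (integrable_const (1 : ℝ))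
    (exp_neg_integral_le_one hf)
  simpa [laplace] using h

lemma laplace_mono [IsProbabilityMeasure F] (hf : IsBPos f) (hg : IsBPos g) (hfg : ∀ x, f x ≤ g x) :
    laplace F g ≤ laplace F f := by
  refine integral_mono (integrable_exp_neg_integral hg F) (integrable_exp_neg_integral hf F) ?_
  intro ν
  refine Real.exp_le_exp.2 (neg_le_neg ?_)
  exact integral_mono (hf.integrable _) (hg.integrable _) hfg

lemma abs_exp_neg_sub_le {a b c : ℝ} (ha : 0 ≤ a) (hb : 0 ≤ b) (hc : |a - b| ≤ c) :
    |Real.exp (-a) - Real.exp (-b)| ≤ 1 - Real.exp (-c) := by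
  obtain ⟨h1, h2⟩ := abs_le.1 hc
  have hc0 : 0 ≤ c := (abs_nonneg _).trans hc
  have key : ∀ u v : ℝ, 0 ≤ u → u - v ≥ -c → Real.exp (-u) - Real.exp (-v) ≤ 1 - Real.exp (-c) := by
    intro u v hu huv
    have e1 : Real.exp (-u) ≤ 1 := Real.exp_le_one_iff.2 (by linarith)
    have e2 : Real.exp (-u) * Real.exp (-c) ≤ Real.exp (-v) := by
      rw [← Real.exp_add]; exact Real.exp_le_exp.2 (by linarith)
    have e3 : Real.exp (-c) ≤ 1 := Real.exp_le_one_iff.2 (by linarith)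
    nlinarith [Real.exp_pos (-u)]
  rw [abs_le]
  constructor
  · linarith [key b a hb (by linarith)]
  · exact key a b ha (by linarith)

/-- The modulus of continuity of a Laplace functional is controlled by its values near `0`. -/
lemma abs_laplace_sub_le [IsProbabilityMeasure F] (hf : IsBPos f) (hg : IsBPos g) :
    |laplace F f - laplace F g| ≤ 1 - laplace F (fun x => |f x - g x|) := by
  have hfg := hf.abs_sub hg
  unfold laplace
  rw [← integral_sub (integrable_exp_neg_integral hf F) (integrable_exp_neg_integral hg F)]
  have h1 : (1 : ℝ) = ∫ _ν : FiniteMeasure E, (1 : ℝ) ∂F := by simp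
  rw [h1, ← integral_sub (integrable_const _) (integrable_exp_neg_integral hfg F)]
  refine (abs_integral_le_integral_abs).trans (integral_mono ?_ ?_ fun ν => ?_)
  · exact ((integrable_exp_neg_integral hf F).sub (integrable_exp_neg_integral hg F)).abs
  · exact (integrable_const _).sub (integrable_exp_neg_integral hfg F)
  · refine abs_exp_neg_sub_le (hf.integral_nonneg _) (hg.integral_nonneg _) ?_
    rw [← integral_sub (hf.integrable _) (hg.integrable _)]
    exact abs_integral_le_integral_abs

/-- Laplace functionals are continuous for bounded pointwise convergence. -/
lemma tendsto_laplace [IsProbabilityMeasure F] {fs : ℕ → E → ℝ} (hfs : ∀ n, IsBPos (fs n))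
    {C : ℝ} (hC : ∀ n x, fs n x ≤ C)
    (hlim : ∀ x, Tendsto (fun n => fs n x) atTop (𝓝 (f x))) :
    Tendsto (fun n => laplace F (fs n)) atTop (𝓝 (laplace F f)) := by
  refine tendsto_integral_of_dominated_convergence (fun _ => (1 : ℝ))
    (fun n => (measurable_exp_neg_integral (hfs n)).aestronglyMeasurable) (integrable_const _)
    (fun n => ae_of_all _ fun ν => ?_) (ae_of_all _ fun ν => ?_)
  · rw [Real.norm_of_nonneg (Real.exp_pos _).le]
    exact exp_neg_integral_le_one (hfs n) ν
  · refine (Real.continuous_exp.tendsto _).comp (Tendsto.neg ?_)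
    refine tendsto_integral_of_dominated_convergence (fun _ => C)
      (fun n => (hfs n).1.aestronglyMeasurable) (integrable_const _)
      (fun n => ae_of_all _ fun x => ?_) (ae_of_all _ hlim)
    rw [Real.norm_of_nonneg ((hfs n).2.1 x)]
    exact hC n x

lemma laplace_zero [IsProbabilityMeasure F] : laplace F (fun _ => 0) = 1 := by simp [laplace]

lemma laplace_dirac (μ : FiniteMeasure E) (hf : IsBPos f) :
    laplace (Measure.dirac μ) f = Real.exp (-∫ x, f x ∂(μ : Measure E)) :=
  integral_dirac' _ _ (measurable_exp_neg_integral hf).stronglyMeasurable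

lemma laplace_conv [IsProbabilityMeasure F] [IsProbabilityMeasure G] (hf : IsBPos f) :
    laplace (F ∗ G) f = laplace F f * laplace G f := by
  unfold laplace Measure.conv
  rw [integral_map measurable_add.aemeasurable
    (measurable_exp_neg_integral hf).aestronglyMeasurable, ← integral_prod_mul]
  refine integral_congr_ae (ae_of_all _ fun p => ?_)
  simp only [FiniteMeasure.toMeasure_add]
  rw [integral_add_measure (hf.integrable _) (hf.integrable _), neg_add, Real.exp_add]

instance isProbabilityMeasure_convPow [IsProbabilityMeasure F] (n : ℕ) :
    IsProbabilityMeasure (convPow F n) := by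
  induction n with
  | zero => exact Measure.dirac.isProbabilityMeasure
  | succ n ih => exact Measure.probabilitymeasure_of_probabilitymeasures_conv _ _

lemma laplace_convPow [IsProbabilityMeasure F] (hf : IsBPos f) (n : ℕ) :
    laplace (convPow F n) f = laplace F f ^ n := by
  induction n with
  | zero => simp [convPow, laplace_dirac 0 hf]
  | succ n ih => rw [convPow, laplace_conv hf, ih, pow_succ]

/-- The Laplace exponent `-log L_F(f)`. -/
noncomputable def lexp (F : Measure (FiniteMeasure E)) (f : E → ℝ) : ℝ := -Real.log (laplace F f)

lemma log_laplace : Real.log (laplace F f) = -lexp F f := (neg_neg _).symm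

lemma exp_neg_lexp [IsProbabilityMeasure F] (hf : IsBPos f) :
    Real.exp (-lexp F f) = laplace F f := by
  rw [lexp, neg_neg, Real.exp_log (laplace_pos hf)]

lemma lexp_nonneg [IsProbabilityMeasure F] (hf : IsBPos f) : 0 ≤ lexp F f :=
  neg_nonneg.2 (Real.log_nonpos (laplace_pos hf).le (laplace_le_one hf))

lemma lexp_mono [IsProbabilityMeasure F] (hf : IsBPos f) (hg : IsBPos g) (hfg : ∀ x, f x ≤ g x) :
    lexp F f ≤ lexp F g :=
  neg_le_neg (Real.log_le_log (laplace_pos hg) (laplace_mono hf hg hfg))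

lemma lexp_conv [IsProbabilityMeasure F] [IsProbabilityMeasure G] (hf : IsBPos f) :
    lexp (F ∗ G) f = lexp F f + lexp G f := by
  rw [lexp, laplace_conv hf, Real.log_mul (laplace_pos hf).ne' (laplace_pos hf).ne', neg_add]
  rfl

lemma lexp_convPow [IsProbabilityMeasure F] (hf : IsBPos f) (n : ℕ) :
    lexp (convPow F n) f = n * lexp F f := by
  rw [lexp, laplace_convPow hf, Real.log_pow, lexp, mul_neg]

/-- Laplace exponents are subhomogeneous, by Jensen's inequality. -/
lemma lexp_natCast_mul_le [IsProbabilityMeasure F] (hf : IsBPos f) (n : ℕ) :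
    lexp F (fun x => n * f x) ≤ n * lexp F f := by
  have hnf : IsBPos (fun x => (n : ℝ) * f x) := hf.const_mul n.cast_nonneg
  have hpow : ∀ ν : FiniteMeasure E, Real.exp (-∫ x, (n : ℝ) * f x ∂(ν : Measure E)) =
      Real.exp (-∫ x, f x ∂(ν : Measure E)) ^ n := by
    intro ν
    rw [integral_const_mul, ← Real.exp_nat_mul]
    congr 1; ring
  have hJ : laplace F f ^ n ≤ laplace F (fun x => n * f x) := by
    unfold laplace
    simp_rw [hpow]
    refine (convexOn_pow n).map_integral_le (continuous_pow n).continuousOn isClosed_Ici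
      (ae_of_all _ fun ν => (Real.exp_pos _).le) (integrable_exp_neg_integral hf F) ?_
    refine (integrable_exp_neg_integral hnf F).congr (ae_of_all _ fun ν => ?_)
    exact hpow ν
  have := Real.log_le_log (pow_pos (laplace_pos hf) n) hJ
  rw [Real.log_pow] at this
  unfold lexp
  linarith

lemma lexp_eq_zero_of_one [IsProbabilityMeasure F] (h : lexp F (fun _ => 1) = 0) (hf : IsBPos f) :
    lexp F f = 0 := by
  obtain ⟨n, -, hn⟩ := hf.exists_nat_bound
  have h1 : lexp F f ≤ lexp F (fun _ => n * 1) :=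
    lexp_mono hf (IsBPos.const (by positivity)) (by simpa using hn)
  have h2 := lexp_natCast_mul_le (F := F) (IsBPos.const (E := E) zero_le_one) n
  have h3 := lexp_nonneg (F := F) hf
  rw [h, mul_zero] at h2
  linarith

end Laplace

/-! ### Uniqueness of measures with a given Laplace functional -/

lemma measure_eq_of_map_eq {α β : Type*} [mα : MeasurableSpace α] [mβ : MeasurableSpace β]
    {F G : Measure α} {ψ : α → β} (hψ : Measurable ψ) (hle : mα ≤ mβ.comap ψ)
    (h : F.map ψ = G.map ψ) : F = G := by
  ext B hB
  obtain ⟨C, hC, rfl⟩ := hle B hB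
  rw [← Measure.map_apply hψ hC, ← Measure.map_apply hψ hC, h]

/-- The nonnegative integer combination `∑ nᵢ 1_{Aᵢ}` of indicators of the sets `Aᵢ`. -/
noncomputable def indicatorSum {E : Type u} (A : ℕ → Set E) (n : ℕ →₀ ℕ) (x : E) : ℝ :=
  n.sum fun i k => (k : ℝ) * (A i).indicator (fun _ => (1 : ℝ)) x

lemma indicatorSum_add {E : Type u} (A : ℕ → Set E) (m n : ℕ →₀ ℕ) (x : E) :
    indicatorSum A (m + n) x = indicatorSum A m x + indicatorSum A n x := by
  unfold indicatorSum
  refine Finsupp.sum_add_index' (fun i => by simp) fun i a b => by push_cast; ring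

section Uniqueness

variable {E : Type u} [MeasurableSpace E]

lemma IsBPos.finsetSum {ι : Type*} (s : Finset ι) {f : ι → E → ℝ} (hf : ∀ i, IsBPos (f i)) :
    IsBPos (fun x => ∑ i ∈ s, f i x) := by
  classical
  induction s using Finset.induction_on with
  | empty => simpa using IsBPos.const (E := E) le_rfl
  | insert a s ha ih =>
    simp only [Finset.sum_insert ha]
    exact (hf a).add ih

lemma isBPos_indicatorSum {A : ℕ → Set E} (hA : ∀ i, MeasurableSet (A i)) (n : ℕ →₀ ℕ) :
    IsBPos (indicatorSum A n) :=
  IsBPos.finsetSum n.support fun i => (IsBPos.indicator_one (hA i)).const_mul (n i).cast_nonneg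

/-- The coordinates `exp(-ν(Aᵢ))` of a finite measure `ν`, as a point of the Hilbert cube. -/
noncomputable def expCoord (A : ℕ → Set E) (hA : ∀ i, MeasurableSet (A i)) (ν : FiniteMeasure E) :
    ℕ → unitInterval :=
  fun i => ⟨Real.exp (-∫ x, (A i).indicator (fun _ => (1 : ℝ)) x ∂(ν : Measure E)),
    (Real.exp_pos _).le, exp_neg_integral_le_one (IsBPos.indicator_one (hA i)) ν⟩

lemma measurable_expCoord {A : ℕ → Set E} (hA : ∀ i, MeasurableSet (A i)) :
    Measurable (expCoord A hA) :=
  measurable_pi_lambda _ fun i =>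
    (measurable_exp_neg_integral (IsBPos.indicator_one (hA i))).subtype_mk

/-- Finite measures are determined, measurably, by their values on a generating set algebra. -/
lemma measurableSpace_le_comap_expCoord {A : ℕ → Set E} (hA : ∀ i, MeasurableSet (A i))
    (halg : IsSetAlgebra (Set.range A))
    (hgen : ‹MeasurableSpace E› = MeasurableSpace.generateFrom (Set.range A)) :
    (inferInstance : MeasurableSpace (FiniteMeasure E)) ≤
      MeasurableSpace.pi.comap (expCoord A hA) := by
  have hbasic : ∀ i, @Measurable _ _ (MeasurableSpace.pi.comap (expCoord A hA)) _
      fun ν : FiniteMeasure E => (ν : Measure E) (A i) := by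
    intro i
    have h1 : (fun ν : FiniteMeasure E => (ν : Measure E) (A i)) =
        fun ν => ENNReal.ofReal (-Real.log (expCoord A hA ν i : ℝ)) := by
      funext ν
      simp [expCoord, integral_indicator_const, hA i, Measure.real]
    rw [h1]
    have hc : Measurable[MeasurableSpace.pi.comap (expCoord A hA)] (expCoord A hA) :=
      comap_measurable _
    have hi : Measurable fun y : ℕ → unitInterval => ENNReal.ofReal (-Real.log (y i : ℝ)) := by
      fun_prop
    exact hi.comp hc
  have huniv : Set.univ ∈ Set.range A := by
    have := halg.compl_mem halg.empty_mem
    simpa using this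
  have hval : @Measurable _ _ (MeasurableSpace.pi.comap (expCoord A hA)) _
      (fun ν : FiniteMeasure E => (ν : Measure E)) := by
    refine @Measurable.measure_of_isPiSystem _ _ (MeasurableSpace.pi.comap (expCoord A hA)) _ _
      (fun ν => ν.isFiniteMeasure) (Set.range A) hgen halg.isSetRing.isSetSemiring.isPiSystem ?_ ?_
    · rintro _ ⟨i, rfl⟩
      exact hbasic i
    · obtain ⟨i, hi⟩ := huniv
      rw [← hi]
      exact hbasic i
  exact hval.comap_le

/-- Some countable family of test functions determines the probability measures on `M(E)`:
the monomials in the coordinates `exp(-ν(Aᵢ))` span an algebra of continuous functions on the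
Hilbert cube that separates points. -/
theorem exists_determining_family (E : Type u) [MeasurableSpace E]
    [MeasurableSpace.CountablyGenerated E] :
    ∃ fs : (ℕ →₀ ℕ) → E → ℝ, (∀ n, IsBPos (fs n)) ∧
      ∀ F G : Measure (FiniteMeasure E), IsProbabilityMeasure F → IsProbabilityMeasure G →
        (∀ n, laplace F (fs n) = laplace G (fs n)) → F = G := by
  obtain ⟨b, hbc, hb⟩ := MeasurableSpace.CountablyGenerated.isCountablyGenerated (α := E)
  have halg := isSetAlgebra_generateSetAlgebra (𝒜 := b)
  obtain ⟨A, hA⟩ := (countable_generateSetAlgebra hbc).exists_eq_range ⟨_, halg.empty_mem⟩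
  have hgen : ‹MeasurableSpace E› = MeasurableSpace.generateFrom (Set.range A) := by
    rw [← hA, generateFrom_generateSetAlgebra_eq, hb]
  have hAm : ∀ i, MeasurableSet (A i) := by
    intro i
    rw [hgen]
    exact MeasurableSpace.measurableSet_generateFrom ⟨i, rfl⟩
  rw [hA] at halg
  refine ⟨indicatorSum A, isBPos_indicatorSum hAm, fun F G hF hG hFG => ?_⟩
  refine measure_eq_of_map_eq (measurable_expCoord hAm)
    (measurableSpace_le_comap_expCoord hAm halg hgen) ?_
  have := Measure.isProbabilityMeasure_map (μ := F) (measurable_expCoord hAm).aemeasurable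
  have := Measure.isProbabilityMeasure_map (μ := G) (measurable_expCoord hAm).aemeasurable
  let coord : ℕ → BoundedContinuousFunction (ℕ → unitInterval) ℝ := fun i =>
    BoundedContinuousFunction.mkOfCompact ⟨fun y => (y i : ℝ), by fun_prop⟩
  let 𝒜 : StarSubalgebra ℝ (BoundedContinuousFunction (ℕ → unitInterval) ℝ) :=
    { Algebra.adjoin ℝ (Set.range coord) with
      star_mem' := fun {a} ha => by
        have : star a = a := by ext; simp
        rwa [this] }
  refine ext_of_forall_mem_subalgebra_integral_eq_of_polish (A := 𝒜) ?_ ?_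
  · intro x y hxy
    obtain ⟨i, hi⟩ := Function.ne_iff.1 hxy
    refine ⟨_, ⟨_, ⟨coord i, Algebra.subset_adjoin ⟨i, rfl⟩, rfl⟩, rfl⟩, ?_⟩
    simpa [coord, Subtype.ext_iff] using hi
  · intro g hg
    have hg' : g ∈ Submodule.span ℝ (Submonoid.closure (Set.range coord) : Set _) := by
      rw [← Algebra.adjoin_eq_span]
      exact hg
    clear hg
    have hmono : ∀ p ∈ Submonoid.closure (Set.range coord), ∃ n : ℕ →₀ ℕ,
        ∀ ν : FiniteMeasure E, p (expCoord A hAm ν) =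
          Real.exp (-∫ x, indicatorSum A n x ∂(ν : Measure E)) := by
      intro p hp
      induction hp using Submonoid.closure_induction with
      | mem p hp =>
        obtain ⟨i, rfl⟩ := hp
        refine ⟨Finsupp.single i 1, fun ν => ?_⟩
        simp [coord, expCoord, indicatorSum]
      | one => exact ⟨0, fun ν => by simp [indicatorSum]⟩
      | mul p q _ _ hp hq =>
        obtain ⟨m, hm⟩ := hp
        obtain ⟨n, hn⟩ := hq
        refine ⟨m + n, fun ν => ?_⟩
        simp_rw [indicatorSum_add]
        rw [integral_add ((isBPos_indicatorSum hAm m).integrable _)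
          ((isBPos_indicatorSum hAm n).integrable _), neg_add, Real.exp_add, ← hm, ← hn]
        rfl
    have hint : ∀ (p : BoundedContinuousFunction (ℕ → unitInterval) ℝ)
        (μ : Measure (ℕ → unitInterval)) [IsProbabilityMeasure μ], Integrable p μ :=
      fun p μ _ => p.integrable μ
    induction hg' using Submodule.span_induction with
    | mem p hp =>
      obtain ⟨n, hn⟩ := hmono p hp
      rw [integral_map (measurable_expCoord hAm).aemeasurable
          p.continuous.measurable.aestronglyMeasurable,
        integral_map (measurable_expCoord hAm).aemeasurable
          p.continuous.measurable.aestronglyMeasurable]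
      simp_rw [hn]
      exact hFG n
    | zero => simp
    | add p q hp' hq' hp hq =>
      have e : ∀ x, (p + q) x = p x + q x := fun _ => rfl
      simp_rw [e]
      rw [integral_add (hint p _) (hint q _), integral_add (hint p _) (hint q _),
        hp, hq]
    | smul c p hp' hp =>
      have e : ∀ x, (c • p) x = c * p x := fun _ => rfl
      simp_rw [e]
      rw [integral_const_mul, integral_const_mul, hp]

lemma laplace_ext [MeasurableSpace.CountablyGenerated E] {F G : Measure (FiniteMeasure E)}
    [IsProbabilityMeasure F] [IsProbabilityMeasure G]
    (h : ∀ f, IsBPos f → laplace F f = laplace G f) : F = G := by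
  obtain ⟨fs, hfs, hdet⟩ := exists_determining_family E
  exact hdet F G ‹_› ‹_› fun n => h _ (hfs n)

end Uniqueness

/-! ### Compactness for Laplace functionals over a compact metrizable space -/

section Compact

variable {X : Type u} [TopologicalSpace X] [MeasurableSpace X] [BorelSpace X]

lemma isBPos_boundedContinuous (g : X →ᵇ ℝ≥0) : IsBPos (fun x => (g x : ℝ)) := by
  refine ⟨(g.continuous.measurable).coe_nnreal_real, fun x => (g x).2, nndist 0 g, fun x => ?_⟩
  exact_mod_cast g.apply_le_nndist_zero x

lemma coe_testAgainstNN (ν : FiniteMeasure X) (g : X →ᵇ ℝ≥0) :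
    (ν.testAgainstNN g : ℝ) = ∫ x, (g x : ℝ) ∂(ν : Measure X) := by
  rw [integral_eq_lintegral_of_nonneg_ae (μ := (ν : Measure X))
    (ae_of_all _ fun x => NNReal.coe_nonneg (g x))
    (isBPos_boundedContinuous g).1.aestronglyMeasurable]
  simp [FiniteMeasure.testAgainstNN, ENNReal.coe_toNNReal_eq_toReal]

/-- The values of a finite measure on a sequence of test functions. -/
noncomputable def testSeq (f : ℕ → X →ᵇ ℝ≥0) (ν : FiniteMeasure X) : ℕ → ℝ≥0 :=
  fun i => ν.testAgainstNN (f i)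

lemma continuous_testSeq (f : ℕ → X →ᵇ ℝ≥0) : Continuous (testSeq f) :=
  continuous_pi fun i => FiniteMeasure.continuous_testAgainstNN_eval (f i)

lemma measurable_testAgainstNN (g : X →ᵇ ℝ≥0) :
    Measurable fun ν : FiniteMeasure X => ν.testAgainstNN g :=
  ((Measure.measurable_lintegral g.continuous.measurable.coe_nnreal_ennreal).comp
    measurable_subtype_coe).ennreal_toNNReal

lemma measurable_testSeq (f : ℕ → X →ᵇ ℝ≥0) : Measurable (testSeq f) :=
  measurable_pi_lambda _ fun i => measurable_testAgainstNN (f i)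

lemma exists_seq_tendsto_testAgainstNN {f : ℕ → X →ᵇ ℝ≥0} (hf : DenseRange f) (g : X →ᵇ ℝ≥0) :
    ∃ i : ℕ → ℕ, Tendsto (fun j => f (i j)) atTop (𝓝 g) ∧ ∀ ν : FiniteMeasure X,
      Tendsto (fun j => testSeq f ν (i j)) atTop (𝓝 (ν.testAgainstNN g)) := by
  obtain ⟨u, hu, hlim⟩ := mem_closure_iff_seq_limit.1 (hf g)
  choose i hi using hu
  obtain rfl : u = fun j => f (i j) := funext fun j => (hi j).symm
  exact ⟨i, hlim, fun ν => (ν.testAgainstNN_lipschitz.continuous.tendsto g).comp hlim⟩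

variable [TopologicalSpace.MetrizableSpace X]

lemma injective_testSeq {f : ℕ → X →ᵇ ℝ≥0} (hf : DenseRange f) :
    Function.Injective (testSeq f) := by
  let := TopologicalSpace.metrizableSpaceMetric X
  intro μ ν h
  refine FiniteMeasure.ext_of_forall_lintegral_eq fun g => ?_
  obtain ⟨i, -, hi⟩ := exists_seq_tendsto_testAgainstNN hf g
  have h1 : μ.testAgainstNN g = ν.testAgainstNN g :=
    tendsto_nhds_unique (hi μ) (by rw [h]; exact hi ν)
  rw [← FiniteMeasure.testAgainstNN_coe_eq, ← FiniteMeasure.testAgainstNN_coe_eq, h1]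

lemma measurableSpace_le_comap_testSeq {f : ℕ → X →ᵇ ℝ≥0} (hf : DenseRange f) :
    (inferInstance : MeasurableSpace (FiniteMeasure X)) ≤
      MeasurableSpace.pi.comap (testSeq f) := by
  let := TopologicalSpace.metrizableSpaceMetric X
  have hc : Measurable[MeasurableSpace.pi.comap (testSeq f)] (testSeq f) := comap_measurable _
  have htest : ∀ g : X →ᵇ ℝ≥0, Measurable[MeasurableSpace.pi.comap (testSeq f)]
      (fun ν : FiniteMeasure X => ν.testAgainstNN g) := by
    intro g
    obtain ⟨i, -, hi⟩ := exists_seq_tendsto_testAgainstNN hf g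
    refine @measurable_of_tendsto_metrizable _ _ (MeasurableSpace.pi.comap (testSeq f)) _ _ _ _
      (fun j ν => testSeq f ν (i j)) _ (fun j => ?_) (tendsto_pi_nhds.2 hi)
    exact (measurable_pi_apply (X := fun _ : ℕ => ℝ≥0) (i j)).comp hc
  have hclosed : ∀ s : Set X, IsClosed s → Measurable[MeasurableSpace.pi.comap (testSeq f)]
      (fun ν : FiniteMeasure X => (ν : Measure X) s) := by
    intro s hs
    refine @measurable_of_tendsto_metrizable _ _ (MeasurableSpace.pi.comap (testSeq f)) _ _ _ _
      (fun j ν => ∫⁻ x, hs.apprSeq j x ∂(ν : Measure X)) _ (fun j => ?_)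
      (tendsto_pi_nhds.2 fun ν => HasOuterApproxClosed.tendsto_lintegral_apprSeq hs _)
    simp_rw [← FiniteMeasure.testAgainstNN_coe_eq]
    exact (htest _).coe_nnreal_ennreal
  have hval : Measurable[MeasurableSpace.pi.comap (testSeq f)]
      (fun ν : FiniteMeasure X => (ν : Measure X)) := by
    refine @Measurable.measure_of_isPiSystem _ _ (MeasurableSpace.pi.comap (testSeq f)) _ _
      (fun ν => ν.isFiniteMeasure) {s | IsClosed s} ?_ isPiSystem_isClosed hclosed
      (hclosed _ isClosed_univ)
    rw [BorelSpace.measurable_eq (α := X)]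
    exact borel_eq_generateFrom_isClosed
  exact hval.comap_le

variable [CompactSpace X]

lemma isCompact_image_testSeq (f : ℕ → X →ᵇ ℝ≥0) (c : ℕ) :
    IsCompact (testSeq f '' {ν | ν.mass ≤ c}) := by
  let := TopologicalSpace.metrizableSpaceMetric X
  exact (isCompact_setOfPred_finiteMeasure_le_of_compactSpace X c).image (continuous_testSeq f)

lemma measurableEmbedding_testSeq {f : ℕ → X →ᵇ ℝ≥0} (hf : DenseRange f) :
    MeasurableEmbedding (testSeq f) := by
  refine MeasurableEmbedding.iff_comap_eq.2 ⟨injective_testSeq hf,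
    le_antisymm (measurable_testSeq f).comap_le (measurableSpace_le_comap_testSeq hf), ?_⟩
  have h : Set.range (testSeq f) = ⋃ c : ℕ, testSeq f '' {ν | ν.mass ≤ c} := by
    rw [← Set.image_iUnion, ← Set.image_univ]
    congr 1
    symm
    rw [Set.eq_univ_iff_forall]
    intro ν
    obtain ⟨c, hc⟩ := exists_nat_ge ν.mass
    exact Set.mem_iUnion.2 ⟨c, hc⟩
  rw [h]
  exact MeasurableSet.iUnion fun c => (isCompact_image_testSeq f c).isClosed.measurableSet

end Compact

section MassTail

variable {E : Type u} [MeasurableSpace E]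

lemma measurableSet_mass_le (c : ℕ) : MeasurableSet {ν : FiniteMeasure E | ν.mass ≤ c} := by
  have h : Measurable fun ν : FiniteMeasure E => ν.mass :=
    ((Measure.measurable_coe MeasurableSet.univ).comp measurable_subtype_coe).ennreal_toNNReal
  exact h measurableSet_Iic

/-- The total mass is large only with small probability if the Laplace functional is close to `1`
at a small constant. -/
lemma measureReal_mass_gt_le (F : Measure (FiniteMeasure E)) [IsProbabilityMeasure F] (k : ℕ) :
    F.real {ν : FiniteMeasure E | ν.mass ≤ (k + 1 : ℕ)}ᶜ ≤
      2 * (1 - laplace F (fun _ => 1 / ((k : ℝ) + 1))) := by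
  have hc : IsBPos (fun _ : E => 1 / ((k : ℝ) + 1)) := IsBPos.const (by positivity)
  have hm := (measurableSet_mass_le (E := E) (k + 1)).compl
  have h1 : F.real {ν : FiniteMeasure E | ν.mass ≤ (k + 1 : ℕ)}ᶜ =
      ∫ ν, ({ν : FiniteMeasure E | ν.mass ≤ (k + 1 : ℕ)}ᶜ).indicator (fun _ => (1 : ℝ)) ν ∂F := by
    rw [integral_indicator_const _ hm]; simp
  have h2 : 2 * (1 - laplace F (fun _ => 1 / ((k : ℝ) + 1))) = ∫ ν : FiniteMeasure E,
      2 * (1 - Real.exp (-∫ _x, 1 / ((k : ℝ) + 1) ∂(ν : Measure E))) ∂F := by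
    rw [integral_const_mul, integral_sub (integrable_const _) (integrable_exp_neg_integral hc F)]
    simp [laplace]
  rw [h1, h2]
  -- the integrand on the right is at least `2 * (1 - exp (-1)) ≥ 1` where the mass exceeds `k + 1`
  refine integral_mono ((integrable_const _).indicator hm)
    (((integrable_const _).sub (integrable_exp_neg_integral hc F)).const_mul 2) fun ν => ?_
  by_cases hν : ν.mass ≤ (k + 1 : ℕ)
  · rw [Set.indicator_of_notMem (by simpa using hν)]
    have := exp_neg_integral_le_one hc ν
    linarith
  · rw [Set.indicator_of_mem (by simpa using hν)]
    have h3 : 1 ≤ ∫ _x, 1 / ((k : ℝ) + 1) ∂(ν : Measure E) := by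
      have h4 : ((k + 1 : ℕ) : ℝ) < ν.mass := by exact_mod_cast not_le.1 hν
      have h5 : (ν : Measure E).real Set.univ = ν.mass := rfl
      rw [integral_const, smul_eq_mul, h5, mul_one_div, le_div_iff₀ (by positivity)]
      push_cast at h4
      linarith
    have h4 : Real.exp (-∫ _x, 1 / ((k : ℝ) + 1) ∂(ν : Measure E)) ≤ Real.exp (-1) :=
      Real.exp_le_exp.2 (by linarith)
    have h5 : Real.exp (-1) ≤ 1 / 2 := by
      have := Real.exp_neg_one_lt_d9
      linarith
    linarith

lemma tendsto_laplace_const_inv (F : Measure (FiniteMeasure E)) [IsProbabilityMeasure F] :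
    Tendsto (fun k : ℕ => laplace F (fun _ => 1 / ((k : ℝ) + 1))) atTop (𝓝 1) := by
  have h := tendsto_laplace (F := F) (fs := fun k _ => 1 / ((k : ℝ) + 1)) (f := fun _ => 0)
    (fun k => IsBPos.const (by positivity)) (C := 1)
    (fun k _ => by rw [div_le_one (by positivity)]; linarith [k.cast_nonneg (α := ℝ)])
    (fun _ => tendsto_one_div_add_atTop_nhds_zero_nat)
  rwa [laplace_zero] at h

/-- If the Laplace functionals of a sequence of laws converge along small constants to values
approaching `1`, then the total masses are uniformly tight. -/
lemma exists_forall_measure_mass_gt_le {F : ℕ → Measure (FiniteMeasure E)}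
    (hF : ∀ n, IsProbabilityMeasure (F n)) {l : ℕ → ℝ}
    (h : ∀ k : ℕ, Tendsto (fun n => laplace (F n) (fun _ => 1 / ((k : ℝ) + 1))) atTop (𝓝 (l k)))
    (hl : ∀ ε > 0, ∃ k, 1 - ε < l k) {ε : ℝ} (hε : 0 < ε) :
    ∃ c : ℕ, ∀ n, (F n).real {ν : FiniteMeasure E | ν.mass ≤ c}ᶜ ≤ ε := by
  have hanti : ∀ n {c d : ℕ}, c ≤ d → (F n).real {ν : FiniteMeasure E | ν.mass ≤ d}ᶜ ≤
      (F n).real {ν : FiniteMeasure E | ν.mass ≤ c}ᶜ := by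
    intro n c d hcd
    have := hF n
    refine measureReal_mono (Set.compl_subset_compl.2 fun ν hν => ?_)
    exact le_trans (b := (c : ℝ≥0)) hν (by exact_mod_cast hcd)
  obtain ⟨k, hk⟩ := hl (ε / 2) (by positivity)
  obtain ⟨n₀, hn₀⟩ := eventually_atTop.1 ((h k).eventually (lt_mem_nhds hk))
  have hsmall : ∀ n ∈ Finset.range n₀, ∀ᶠ c : ℕ in atTop,
      (F n).real {ν : FiniteMeasure E | ν.mass ≤ c}ᶜ ≤ ε := by
    intro n _
    have := hF n
    obtain ⟨j, hj⟩ := ((tendsto_laplace_const_inv (F n)).eventually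
      (lt_mem_nhds (show 1 - ε / 2 < 1 by linarith))).exists
    filter_upwards [eventually_ge_atTop (j + 1)] with c hc
    refine (hanti n hc).trans ((measureReal_mass_gt_le (F n) j).trans ?_)
    linarith
  obtain ⟨c, hc, hck⟩ := (((Finset.range n₀).eventually_all.2 hsmall).and
    (eventually_ge_atTop (k + 1))).exists
  refine ⟨c, fun n => ?_⟩
  by_cases hn : n < n₀
  · exact hc n (Finset.mem_range.2 hn)
  · have := hF n
    refine (hanti n hck).trans ((measureReal_mass_gt_le (F n) k).trans ?_)
    linarith [hn₀ n (not_lt.1 hn)]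

end MassTail

section Compact

variable {X : Type u} [TopologicalSpace X] [MeasurableSpace X] [BorelSpace X]
  [CompactSpace X] [TopologicalSpace.MetrizableSpace X]

/-- A limit of Laplace functionals along a dense sequence of test functions is a Laplace
functional, provided that no mass escapes. The laws are pushed to the Polish space `ℕ → ℝ≥0`
by `testSeq f`, which maps the measures of bounded mass to compact sets, and Prokhorov's theorem
applies there. -/
theorem exists_laplace_eq_of_tendsto {f : ℕ → X →ᵇ ℝ≥0} (hf : DenseRange f)
    {F : ℕ → Measure (FiniteMeasure X)} (hF : ∀ n, IsProbabilityMeasure (F n)) {l l' : ℕ → ℝ}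
    (h : ∀ i, Tendsto (fun n => laplace (F n) (fun x => (f i x : ℝ))) atTop (𝓝 (l i)))
    (h' : ∀ k : ℕ, Tendsto (fun n => laplace (F n) (fun _ => 1 / ((k : ℝ) + 1))) atTop (𝓝 (l' k)))
    (hl' : ∀ ε > 0, ∃ k, 1 - ε < l' k) :
    ∃ K : Measure (FiniteMeasure X), IsProbabilityMeasure K ∧
      ∀ i, laplace K (fun x => (f i x : ℝ)) = l i := by
  have hψ := measurableEmbedding_testSeq hf
  have hprob : ∀ n, IsProbabilityMeasure ((F n).map (testSeq f)) := fun n =>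
    have := hF n
    Measure.isProbabilityMeasure_map hψ.measurable.aemeasurable
  let P : ℕ → ProbabilityMeasure (ℕ → ℝ≥0) := fun n => ⟨(F n).map (testSeq f), hprob n⟩
  have hcpt : ∀ ε : ℝ, 0 < ε → ∃ C : Set (ℕ → ℝ≥0), IsCompact C ∧ C ⊆ Set.range (testSeq f) ∧
      ∀ n, (P n : Measure (ℕ → ℝ≥0)) Cᶜ ≤ ENNReal.ofReal ε := by
    intro ε hε
    obtain ⟨c, hc⟩ := exists_forall_measure_mass_gt_le hF h' hl' hε
    refine ⟨testSeq f '' {ν | ν.mass ≤ c}, isCompact_image_testSeq f c, Set.image_subset_range _ _,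
      fun n => ?_⟩
    have := hF n
    change (F n).map (testSeq f) _ ≤ _
    rw [Measure.map_apply hψ.measurable (isCompact_image_testSeq f c).isClosed.measurableSet.compl,
      Set.preimage_compl, Set.preimage_image_eq _ hψ.injective, ← ofReal_measureReal]
    exact ENNReal.ofReal_le_ofReal (hc n)
  have htight : IsTightMeasureSet
      {((μ : ProbabilityMeasure (ℕ → ℝ≥0)) : Measure (ℕ → ℝ≥0)) | μ ∈ Set.range P} := by
    rw [isTightMeasureSet_iff_exists_isCompact_measure_compl_le]
    intro ε hε
    by_cases htop : ε = ⊤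
    · exact ⟨∅, isCompact_empty, fun _ _ => htop ▸ le_top⟩
    obtain ⟨C, hC, -, hle⟩ := hcpt ε.toReal (ENNReal.toReal_pos hε.ne' htop)
    refine ⟨C, hC, ?_⟩
    rintro _ ⟨_, ⟨n, rfl⟩, rfl⟩
    rw [← ENNReal.ofReal_toReal htop]
    exact hle n
  obtain ⟨P₀, -, φ, hφ, hlim⟩ := (isCompact_closure_of_isTightMeasureSet htight).tendsto_subseq
    (fun n => subset_closure (Set.mem_range_self n))
  have hrange : (P₀ : Measure (ℕ → ℝ≥0)) (Set.range (testSeq f))ᶜ = 0 := by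
    refine le_antisymm (ENNReal.le_of_forall_pos_le_add fun ε hε _ => ?_) zero_le
    obtain ⟨C, hC, hCr, hle⟩ := hcpt ε (by exact_mod_cast hε)
    calc (P₀ : Measure (ℕ → ℝ≥0)) (Set.range (testSeq f))ᶜ
        ≤ (P₀ : Measure (ℕ → ℝ≥0)) Cᶜ := measure_mono (Set.compl_subset_compl.2 hCr)
      _ ≤ atTop.liminf fun n => (P (φ n) : Measure (ℕ → ℝ≥0)) Cᶜ :=
          ProbabilityMeasure.le_liminf_measure_open_of_tendsto hlim hC.isClosed.isOpen_compl
      _ ≤ atTop.liminf fun _ : ℕ => ENNReal.ofReal ε := liminf_le_liminf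
          (Eventually.of_forall fun n => hle (φ n))
      _ = 0 + ε := by simp
  have hmap : ((P₀ : Measure (ℕ → ℝ≥0)).comap (testSeq f)).map (testSeq f) = P₀ := by
    rw [hψ.map_comap]
    exact Measure.restrict_eq_self_of_ae_mem (by rw [ae_iff]; exact hrange)
  have hK : IsProbabilityMeasure ((P₀ : Measure (ℕ → ℝ≥0)).comap (testSeq f)) := by
    constructor
    have h1 := congrArg (fun μ : Measure (ℕ → ℝ≥0) => μ Set.univ) hmap
    simp only [Measure.map_apply hψ.measurable MeasurableSet.univ, Set.preimage_univ,
      measure_univ] at h1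
    exact h1
  refine ⟨_, hK, fun i => ?_⟩
  let e : (ℕ → ℝ≥0) →ᵇ ℝ := BoundedContinuousFunction.ofNormedAddCommGroup
    (fun y => Real.exp (-(y i : ℝ))) (by fun_prop) 1 (fun y => by
      rw [Real.norm_of_nonneg (Real.exp_pos _).le]
      exact Real.exp_le_one_iff.2 (neg_nonpos.2 (y i).2))
  have hlap : ∀ F : Measure (FiniteMeasure X),
      laplace F (fun x => (f i x : ℝ)) = ∫ y, e y ∂(F.map (testSeq f)) := by
    intro F
    rw [integral_map hψ.measurable.aemeasurable e.continuous.measurable.aestronglyMeasurable]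
    refine integral_congr_ae (ae_of_all _ fun ν => ?_)
    simp only [← coe_testAgainstNN]
    rfl
  rw [hlap, hmap]
  refine tendsto_nhds_unique
    ((ProbabilityMeasure.tendsto_iff_forall_integral_tendsto.1 hlim) e) ?_
  refine ((h i).comp hφ.tendsto_atTop).congr fun n => ?_
  exact hlap _

end Compact

/-! ### Bounded pointwise limits of continuous functions -/

section Baire

/-- The smallest class of functions containing the continuous functions with values in `[0, c]` and
closed under pointwise limits of sequences. -/
inductive BaireClass {X : Type u} [TopologicalSpace X] (c : ℝ) : (X → ℝ) → Prop
  | of_continuous (g : X → ℝ) (hg : Continuous g) (hgc : ∀ x, g x ∈ Set.Icc 0 c) : BaireClass c g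
  | of_tendsto (gs : ℕ → X → ℝ) (g : X → ℝ) (hgs : ∀ n, BaireClass c (gs n))
      (hlim : ∀ x, Tendsto (fun n => gs n x) atTop (𝓝 (g x))) : BaireClass c g

variable {X : Type u} [TopologicalSpace X] {c : ℝ}

lemma BaireClass.mem_Icc {g : X → ℝ} (hg : BaireClass c g) (x : X) : g x ∈ Set.Icc 0 c := by
  induction hg with
  | of_continuous g hg hgc => exact hgc x
  | of_tendsto gs g hgs hlim ih => exact isClosed_Icc.mem_of_tendsto (hlim x) (.of_forall ih)

lemma BaireClass.comp₂ {Φ : ℝ → ℝ → ℝ} (hΦ : Continuous (Function.uncurry Φ))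
    (hΦc : ∀ a ∈ Set.Icc 0 c, ∀ b ∈ Set.Icc 0 c, Φ a b ∈ Set.Icc 0 c) {f g : X → ℝ}
    (hf : BaireClass c f) (hg : BaireClass c g) : BaireClass c (fun x => Φ (f x) (g x)) := by
  induction hg with
  | of_continuous g hg hgc =>
    induction hf with
    | of_continuous f hf hfc =>
      exact .of_continuous _ (hΦ.comp (hf.prodMk hg)) fun x => hΦc _ (hfc x) _ (hgc x)
    | of_tendsto fs f hfs hlim ih =>
      exact .of_tendsto _ _ ih fun x =>
        (hΦ.tendsto (f x, g x)).comp ((hlim x).prodMk_nhds tendsto_const_nhds)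
  | of_tendsto gs g hgs hlim ih =>
    exact .of_tendsto _ _ ih fun x =>
      (hΦ.tendsto (f x, g x)).comp (tendsto_const_nhds.prodMk_nhds (hlim x))

variable [MeasurableSpace X] [BorelSpace X] [TopologicalSpace.MetrizableSpace X]

lemma BaireClass.indicator (hc : 0 ≤ c) {A : Set X} (hA : MeasurableSet A) :
    BaireClass c (A.indicator fun _ => c) := by
  let := TopologicalSpace.metrizableSpaceMetric X
  have hzero : BaireClass c (fun _ : X => (0 : ℝ)) :=
    .of_continuous _ continuous_const fun _ => ⟨le_rfl, hc⟩
  induction A, hA using MeasurableSpace.induction_on_inter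
    ((BorelSpace.measurable_eq (α := X)).trans borel_eq_generateFrom_isClosed)
    isPiSystem_isClosed with
  | empty => simpa using hzero
  | basic A hA =>
    have hA : IsClosed A := hA
    refine .of_tendsto (fun n x => c * (hA.apprSeq n x : ℝ)) _ (fun n => ?_) fun x => ?_
    · refine .of_continuous _ (by fun_prop) fun x => ⟨by positivity, ?_⟩
      refine mul_le_of_le_one_right hc ?_
      exact_mod_cast HasOuterApproxClosed.apprSeq_apply_le_one hA n x
    · have h1 := tendsto_pi_nhds.1 (HasOuterApproxClosed.tendsto_apprSeq hA) x
      have h2 := ((NNReal.tendsto_coe.2 h1).const_mul c)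
      convert h2 using 2
      by_cases hx : x ∈ A <;> simp [hx]
  | compl A hA ih =>
    have h := BaireClass.comp₂ (Φ := fun a _ => c - a) (by fun_prop)
      (fun a ha b hb => ⟨by linarith [ha.2], by linarith [ha.1]⟩) ih hzero
    convert h using 2 with x
    by_cases hx : x ∈ A <;> simp [hx]
  | iUnion A hd hA ih =>
    have hfin : ∀ n, BaireClass c ((⋃ i < n, A i).indicator fun _ => c) := by
      intro n
      induction n with
      | zero => simpa using hzero
      | succ n ihn =>
        have h := BaireClass.comp₂ (Φ := fun a b => min (a + b) c) (by fun_prop)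
          (fun a ha b hb => ⟨le_min (add_nonneg ha.1 hb.1) hc, min_le_right _ _⟩) ihn (ih n)
        convert h using 2 with x
        rw [Set.biUnion_lt_succ]
        by_cases h1 : x ∈ ⋃ i < n, A i <;> by_cases h2 : x ∈ A n <;>
          simp only [Set.indicator_of_mem, Set.indicator_of_notMem, Set.mem_union, h1, h2, or_true,
            true_or, or_self, not_false_eq_true] <;> simp [hc]
    refine .of_tendsto _ _ hfin fun x => ?_
    refine tendsto_const_nhds.congr' ?_
    by_cases hx : x ∈ ⋃ i, A i
    · obtain ⟨i, hi⟩ := Set.mem_iUnion.1 hx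
      filter_upwards [eventually_gt_atTop i] with n hn
      have : x ∈ ⋃ j < n, A j := Set.mem_biUnion (x := i) hn hi
      simp only [Set.indicator_of_mem, hx, this]
    · refine .of_forall fun n => ?_
      have : x ∉ ⋃ j < n, A j := fun h => hx (Set.iUnion₂_subset_iUnion _ _ h)
      simp only [Set.indicator_of_notMem, hx, this, not_false_eq_true]

lemma BaireClass.of_simpleFunc (hc : 0 < c) (f : SimpleFunc X ℝ≥0) :
    BaireClass c (fun x => min (f x : ℝ) c) := by
  induction f using SimpleFunc.induction with
  | const a hA =>
    rename_i A
    have hind := BaireClass.indicator hc.le hA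
    have h := BaireClass.comp₂ (Φ := fun x _ => min (a : ℝ) c / c * x) (by fun_prop)
      (fun x hx b hb => ⟨mul_nonneg (by positivity) hx.1, ?_⟩) hind hind
    · convert h using 2 with x
      by_cases hx : x ∈ A
      · simp [hx, hc.ne']
      · simp [hx, hc.le]
    · calc min (a : ℝ) c / c * x ≤ 1 * c := by
            refine mul_le_mul ?_ hx.2 hx.1 zero_le_one
            rw [div_le_one hc]
            exact min_le_right _ _
        _ = c := one_mul c
  | add hfg hf hg =>
    rename_i f g
    have h := BaireClass.comp₂ (Φ := fun a b => min (a + b) c) (by fun_prop)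
      (fun a ha b hb => ⟨le_min (add_nonneg ha.1 hb.1) hc.le, min_le_right _ _⟩) hf hg
    convert h using 2 with x
    have h1 : (0 : ℝ) ≤ f x := (f x).2
    have h2 : (0 : ℝ) ≤ g x := (g x).2
    simp only [SimpleFunc.coe_add, Pi.add_apply, NNReal.coe_add]
    rcases le_total (f x : ℝ) c with h3 | h3 <;> rcases le_total (g x : ℝ) c with h4 | h4
    · rw [min_eq_left h3, min_eq_left h4]
    · rw [min_eq_left h3, min_eq_right h4, min_eq_right (by linarith), min_eq_right (by linarith)]
    · rw [min_eq_right h3, min_eq_left h4, min_eq_right (by linarith), min_eq_right (by linarith)]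
    · rw [min_eq_right h3, min_eq_right h4, min_eq_right (by linarith), min_eq_right (by linarith)]

lemma BaireClass.of_measurable (hc : 0 < c) {f : X → ℝ} (hf : Measurable f)
    (hfc : ∀ x, f x ∈ Set.Icc 0 c) : BaireClass c f := by
  have hm : StronglyMeasurable (fun x => (f x).toNNReal) := hf.real_toNNReal.stronglyMeasurable
  refine .of_tendsto _ _ (fun n => BaireClass.of_simpleFunc hc (hm.approx n)) fun x => ?_
  have h1 := (NNReal.tendsto_coe.2 (hm.tendsto_approx x)).min (tendsto_const_nhds (x := c))
  rwa [Real.coe_toNNReal _ (hfc x).1, min_eq_left (hfc x).2] at h1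

/-- Induction principle: a property of functions in `B(X)⁺` that holds for continuous functions and
passes to bounded pointwise limits of sequences holds on the whole of `B(X)⁺`. -/
theorem IsBPos.induction_of_tendsto {P : (X → ℝ) → Prop}
    (hcont : ∀ g : X →ᵇ ℝ≥0, P (fun x => (g x : ℝ)))
    (hlim : ∀ (fs : ℕ → X → ℝ) (f : X → ℝ) (C : ℝ), (∀ n, IsBPos (fs n)) → (∀ n, P (fs n)) →
      (∀ n x, fs n x ≤ C) → (∀ x, Tendsto (fun n => fs n x) atTop (𝓝 (f x))) → P f)
    {f : X → ℝ} (hf : IsBPos f) : P f := by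
  obtain ⟨n, hn, hfn⟩ := hf.exists_nat_bound
  have hn0 : (0 : ℝ) < n := by exact_mod_cast hn
  have key : ∀ g : X → ℝ, BaireClass (n : ℝ) g → Measurable g ∧ P g := by
    intro g hg
    induction hg with
    | of_continuous g hg hgc =>
      refine ⟨hg.measurable, ?_⟩
      have h := hcont ⟨⟨fun x => (g x).toNNReal, continuous_real_toNNReal.comp hg⟩, n, fun x y => by
        have hx := hgc x
        have hy := hgc y
        rw [NNReal.dist_eq, Real.coe_toNNReal _ hx.1, Real.coe_toNNReal _ hy.1, abs_le]
        constructor <;> linarith [hx.1, hx.2, hy.1, hy.2]⟩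
      convert h using 2 with x
      exact (Real.coe_toNNReal _ (hgc x).1).symm
    | of_tendsto gs g hgs hl ih =>
      refine ⟨measurable_of_tendsto_metrizable (fun k => (ih k).1) (tendsto_pi_nhds.2 hl), ?_⟩
      exact hlim gs g n (fun k => ⟨(ih k).1, fun x => ((hgs k).mem_Icc x).1, n,
        fun x => ((hgs k).mem_Icc x).2⟩) (fun k => (ih k).2) (fun k x => ((hgs k).mem_Icc x).2) hl
  exact (key f (BaireClass.of_measurable hn0 hf.1 fun x => ⟨hf.2.1 x, hfn x⟩)).2

end Baire

/-! ### Construction of random measures from families of functionals -/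

section Existence

variable {E X : Type u} [MeasurableSpace E] [MeasurableSpace X]

lemma measurable_finiteMeasure_map {φ : E → X} (hφ : Measurable φ) :
    Measurable fun ν : FiniteMeasure E => ν.map φ :=
  Measurable.subtype_mk ((Measure.measurable_map φ hφ).comp measurable_subtype_coe)

lemma laplace_map_map {F : Measure (FiniteMeasure E)} {φ : E → X} (hφ : Measurable φ) {g : X → ℝ}
    (hg : IsBPos g) :
    laplace (F.map fun ν => ν.map φ) g = laplace F (fun x => g (φ x)) := by
  unfold laplace
  rw [integral_map (measurable_finiteMeasure_map hφ).aemeasurable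
    (measurable_exp_neg_integral hg).aestronglyMeasurable]
  refine integral_congr_ae (ae_of_all _ fun ν => ?_)
  simp only [FiniteMeasure.toMeasure_map]
  rw [integral_map hφ.aemeasurable hg.1.aestronglyMeasurable]

lemma measurable_finiteMeasure_comap {φ : E → X} (hφ : MeasurableEmbedding φ) :
    Measurable fun ν : FiniteMeasure X => ν.comap φ := by
  refine Measurable.subtype_mk (Measure.measurable_of_measurable_coe _ fun A hA => ?_)
  simp_rw [hφ.comap_apply]
  exact (Measure.measurable_coe (hφ.measurableSet_image.2 hA)).comp measurable_subtype_coe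

lemma isBPos_extend {φ : E → X} (hφ : MeasurableEmbedding φ) {f : E → ℝ} (hf : IsBPos f) :
    IsBPos (Function.extend φ f 0) := by
  obtain ⟨hfm, hf0, C, hC⟩ := hf
  refine ⟨hφ.measurable_extend hfm measurable_zero, fun x => ?_, max C 0, fun x => ?_⟩
  all_goals
    by_cases hx : ∃ y, φ y = x
    · obtain ⟨y, rfl⟩ := hx
      simp [hφ.injective.extend_apply, hf0, hC]
    · simp [Function.extend_apply' _ _ _ hx]

lemma laplace_map_comap {F : Measure (FiniteMeasure X)} {φ : E → X} (hφ : MeasurableEmbedding φ)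
    {f : E → ℝ} (hf : IsBPos f) :
    laplace (F.map fun ν => ν.comap φ) f = laplace F (Function.extend φ f 0) := by
  unfold laplace
  rw [integral_map (measurable_finiteMeasure_comap hφ).aemeasurable
    (measurable_exp_neg_integral hf).aestronglyMeasurable]
  refine integral_congr_ae (ae_of_all _ fun ν => ?_)
  have h1 : ∀ x, f x = Function.extend φ f 0 (φ x) := fun x =>
    (hφ.injective.extend_apply f 0 x).symm
  have h2 : ∫ x, f x ∂((ν.comap φ : FiniteMeasure E) : Measure E) =
      ∫ x, Function.extend φ f 0 x ∂(ν : Measure X) := by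
    rw [FiniteMeasure.toMeasure_comap]
    simp_rw [h1]
    rw [← hφ.integral_map, hφ.map_comap]
    refine setIntegral_eq_integral_of_forall_compl_eq_zero fun x hx => ?_
    exact Function.extend_apply' _ _ _ hx
  simp only [h2]

/-- The space `E` is, as a measurable space, a Borel subset of a compact metric space. -/
lemma exists_measurableEmbedding_compact (E : Type u) [TopologicalSpace E]
    [LusinTopologicalSpace E] [MeasurableSpace E] [BorelSpace E] :
    ∃ (X : Type u) (_ : MetricSpace X) (_ : CompactSpace X) (_ : MeasurableSpace X)
      (_ : BorelSpace X) (φ : E → X), MeasurableEmbedding φ := by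
  obtain ⟨X, hX, hc, φ, hφ, hr⟩ := LusinTopologicalSpace.exists_embedding (E := E)
  let mX : MeasurableSpace X := borel X
  have hB : BorelSpace X := ⟨rfl⟩
  exact ⟨X, hX, hc, mX, hB, φ, hφ.measurableEmbedding hr⟩

lemma countablyGenerated_of_lusin (E : Type u) [TopologicalSpace E]
    [LusinTopologicalSpace E] [MeasurableSpace E] [BorelSpace E] :
    MeasurableSpace.CountablyGenerated E := by
  obtain ⟨X, hX, hc, φ, hφ, -⟩ := LusinTopologicalSpace.exists_embedding (E := E)
  have : SecondCountableTopology E := hφ.isInducing.secondCountableTopology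
  infer_instance

/-- The functions `f ↦ u f s`, for `s ∈ S`, are almost everywhere pointwise limits of Laplace
functionals along countable families of test functions, and almost everywhere continuous at `0`
along decreasing sequences. No measurability in `s` is asked for. -/
structure IsLaplaceLimit {S : Type*} [MeasurableSpace S] (ζ : Measure S)
    (u : (E → ℝ) → S → ℝ) : Prop where
  approx : ∀ {ι : Type} [Countable ι] (fs : ι → E → ℝ), (∀ i, IsBPos (fs i)) →
    ∀ᵐ s ∂ζ, ∃ F : ℕ → Measure (FiniteMeasure E), (∀ n, IsProbabilityMeasure (F n)) ∧
      ∀ i, Tendsto (fun n => laplace (F n) (fs i)) atTop (𝓝 (u (fs i) s))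
  tendsto_one : ∀ fs : ℕ → E → ℝ, (∀ i, IsBPos (fs i)) → (∀ x, Antitone fun i => fs i x) →
    (∀ x, Tendsto (fun i => fs i x) atTop (𝓝 0)) →
    ∀ᵐ s ∂ζ, Tendsto (fun i => u (fs i) s) atTop (𝓝 1)

namespace IsLaplaceLimit

variable {S : Type*} [MeasurableSpace S] {ζ : Measure S} {u : (E → ℝ) → S → ℝ}

/-- Almost everywhere continuity along bounded pointwise convergent sequences: the differences are
dominated by a sequence decreasing to `0`. -/
lemma tendsto_of_bounded (hu : IsLaplaceLimit ζ u) {fs : ℕ → E → ℝ} {f : E → ℝ}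
    (hfs : ∀ n, IsBPos (fs n)) (hf : IsBPos f) {C : ℝ} (hC : ∀ n x, fs n x ≤ C)
    (hlim : ∀ x, Tendsto (fun n => fs n x) atTop (𝓝 (f x))) :
    ∀ᵐ s ∂ζ, Tendsto (fun n => u (fs n) s) atTop (𝓝 (u f s)) := by
  obtain ⟨m, -, hm⟩ := hf.exists_nat_bound
  have hdle : ∀ n x, |fs n x - f x| ≤ |C| + m := by
    intro n x
    rw [abs_le]
    have h1 := (hfs n).2.1 x
    have h2 := hf.2.1 x
    have h3 := (hC n x).trans (le_abs_self C)
    constructor <;> linarith [hm x, abs_nonneg C, m.cast_nonneg (α := ℝ)]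
  let g : ℕ → E → ℝ := fun n x => ⨆ j, |fs (n + j) x - f x|
  have hbdd : ∀ n x, BddAbove (Set.range fun j => |fs (n + j) x - f x|) := fun n x =>
    ⟨|C| + m, by rintro _ ⟨j, rfl⟩; exact hdle _ x⟩
  have hg0 : ∀ n x, 0 ≤ g n x := fun n x => Real.iSup_nonneg fun j => abs_nonneg _
  have hgpos : ∀ n, IsBPos (g n) := fun n =>
    ⟨Measurable.iSup fun j => (((hfs _).abs_sub hf).1), hg0 n, |C| + m,
      fun x => ciSup_le fun j => hdle _ x⟩
  have hanti : ∀ x, Antitone fun n => g n x := by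
    intro x n k hnk
    refine ciSup_le fun j => ?_
    obtain ⟨d, rfl⟩ := Nat.exists_eq_add_of_le hnk
    have := le_ciSup (hbdd n x) (d + j)
    rwa [← add_assoc] at this
  have hgle : ∀ n x, |fs n x - f x| ≤ g n x := fun n x => le_ciSup (hbdd n x) 0
  have hgt : ∀ x, Tendsto (fun n => g n x) atTop (𝓝 0) := by
    intro x
    rw [Metric.tendsto_atTop]
    intro ε hε
    obtain ⟨N, hN⟩ := Metric.tendsto_atTop.1 (hlim x) (ε / 2) (by positivity)
    refine ⟨N, fun n hn => ?_⟩
    rw [Real.dist_eq, sub_zero, abs_of_nonneg (hg0 n x)]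
    have h1 : g n x ≤ ε / 2 := ciSup_le fun j => (hN (n + j) (by omega)).le
    linarith
  have hone := hu.tendsto_one g hgpos hanti hgt
  let fam : ℕ ⊕ ℕ ⊕ Unit → E → ℝ := Sum.elim fs (Sum.elim g fun _ => f)
  have hfam : ∀ i, IsBPos (fam i) := by
    rintro (i | i | i)
    exacts [hfs i, hgpos i, hf]
  filter_upwards [hone, hu.approx fam hfam] with s h1 ⟨F, hF, hFl⟩
  have hle : ∀ n, |u (fs n) s - u f s| ≤ 1 - u (g n) s := by
    intro n
    refine le_of_tendsto_of_tendsto'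
      ((hFl (Sum.inl n)).sub (hFl (Sum.inr (Sum.inr ())))).abs
      (tendsto_const_nhds.sub (hFl (Sum.inr (Sum.inl n)))) fun k => ?_
    have := hF k
    refine (abs_laplace_sub_le (hfs n) hf).trans (sub_le_sub_left ?_ 1)
    exact laplace_mono ((hfs n).abs_sub hf) (hgpos n) (hgle n)
  rw [tendsto_iff_norm_sub_tendsto_zero]
  refine squeeze_zero (fun n => norm_nonneg _) hle ?_
  simpa using h1.const_sub 1

/-- Existence of random measures with almost everywhere prescribed Laplace functionals. The
functional is first realized over a compact space on a countable dense set of continuous functions,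
and the identity is then extended to all test functions by bounded pointwise limits. -/
theorem exists_laplace_eq [TopologicalSpace E] [LusinTopologicalSpace E] [BorelSpace E]
    (hu : IsLaplaceLimit ζ u) :
    ∃ K : S → Measure (FiniteMeasure E), (∀ s, IsProbabilityMeasure (K s)) ∧
      ∀ f, IsBPos f → ∀ᵐ s ∂ζ, laplace (K s) f = u f s := by
  obtain ⟨X, hX, hXc, mX, hB, φ, hφ⟩ := exists_measurableEmbedding_compact E
  let e := ContinuousMap.isometryEquivBoundedOfCompact X ℝ≥0
  let f : ℕ → X →ᵇ ℝ≥0 := fun i => e (TopologicalSpace.denseSeq C(X, ℝ≥0) i)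
  have hf : DenseRange f := e.surjective.denseRange.comp
    (TopologicalSpace.denseRange_denseSeq _) e.continuous
  let fam : ℕ ⊕ ℕ → E → ℝ := Sum.elim (fun i x => (f i (φ x) : ℝ)) fun k _ => 1 / ((k : ℝ) + 1)
  have hfam : ∀ i, IsBPos (fam i) := by
    rintro (i | k)
    · exact (isBPos_boundedContinuous (f i)).comp hφ.measurable
    · exact IsBPos.const (show 0 ≤ 1 / ((k : ℝ) + 1) by positivity)
  have hK : ∀ᵐ s ∂ζ, ∃ K : Measure (FiniteMeasure X), IsProbabilityMeasure K ∧
      ∀ i, laplace K (fun x => (f i x : ℝ)) = u (fun x => (f i (φ x) : ℝ)) s := by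
    have hone := hu.tendsto_one (fun k _ => 1 / ((k : ℝ) + 1))
      (fun k => IsBPos.const (show 0 ≤ 1 / ((k : ℝ) + 1) by positivity))
      (fun _ i j hij => one_div_le_one_div_of_le (show (0 : ℝ) < (i : ℝ) + 1 by positivity)
        (by gcongr))
      (fun _ => tendsto_one_div_add_atTop_nhds_zero_nat)
    filter_upwards [hone, hu.approx fam hfam] with s h1 ⟨F, hF, hFl⟩
    refine exists_laplace_eq_of_tendsto hf (F := fun n => (F n).map fun ν => ν.map φ)
      (fun n => ?_) (l' := fun k => u (fun _ => 1 / ((k : ℝ) + 1)) s) (fun i => ?_) (fun k => ?_) ?_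
    · have := hF n
      exact Measure.isProbabilityMeasure_map
        (measurable_finiteMeasure_map hφ.measurable).aemeasurable
    · simp_rw [laplace_map_map hφ.measurable (isBPos_boundedContinuous (f i))]
      exact hFl (Sum.inl i)
    · simp_rw [laplace_map_map hφ.measurable (IsBPos.const (E := X) (c := 1 / ((k : ℝ) + 1))
        (by positivity))]
      exact hFl (Sum.inr k)
    · intro ε hε
      exact (h1.eventually (lt_mem_nhds (show 1 - ε < 1 by linarith))).exists
  have hK' : ∃ K : S → Measure (FiniteMeasure X), (∀ s, IsProbabilityMeasure (K s)) ∧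
      ∀ᵐ s ∂ζ, ∀ i, laplace (K s) (fun x => (f i x : ℝ)) = u (fun x => (f i (φ x) : ℝ)) s := by
    classical
    refine ⟨fun s => if h : ∃ K : Measure (FiniteMeasure X), IsProbabilityMeasure K ∧
      ∀ i, laplace K (fun x => (f i x : ℝ)) = u (fun x => (f i (φ x) : ℝ)) s then h.choose
      else Measure.dirac 0, fun s => ?_, ?_⟩
    · dsimp only
      split_ifs with h
      · exact h.choose_spec.1
      · infer_instance
    · filter_upwards [hK] with s h
      rw [dif_pos h]
      exact h.choose_spec.2
  obtain ⟨K, hKp, hKl⟩ := hK'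
  have hlim : ∀ (gs : ℕ → X → ℝ) (g : X → ℝ) (C : ℝ), (∀ n, IsBPos (gs n)) →
      (∀ n, ∀ᵐ s ∂ζ, laplace (K s) (gs n) = u (fun x => gs n (φ x)) s) →
      (∀ n x, gs n x ≤ C) → (∀ x, Tendsto (fun n => gs n x) atTop (𝓝 (g x))) →
      ∀ᵐ s ∂ζ, laplace (K s) g = u (fun x => g (φ x)) s := by
    intro gs g C hgs hP hC hlim
    have hg : IsBPos g := ⟨measurable_of_tendsto_metrizable (fun n => (hgs n).1)
      (tendsto_pi_nhds.2 hlim), fun x => ge_of_tendsto' (hlim x) fun n => (hgs n).2.1 x, C,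
      fun x => le_of_tendsto' (hlim x) fun n => hC n x⟩
    filter_upwards [ae_all_iff.2 hP, hu.tendsto_of_bounded (fun n => (hgs n).comp hφ.measurable)
      (hg.comp hφ.measurable) (fun n x => hC n (φ x)) fun x => hlim (φ x)] with s h1 h2
    have := hKp s
    refine tendsto_nhds_unique (tendsto_laplace hgs hC hlim) ?_
    simp_rw [h1]
    exact h2
  have hall : ∀ g : X → ℝ, IsBPos g → ∀ᵐ s ∂ζ, laplace (K s) g = u (fun x => g (φ x)) s := by
    intro g hg
    refine IsBPos.induction_of_tendsto
      (P := fun g => ∀ᵐ s ∂ζ, laplace (K s) g = u (fun x => g (φ x)) s) (fun g => ?_) hlim hg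
    obtain ⟨v, hv, hvl⟩ := mem_closure_iff_seq_limit.1 (hf g)
    choose i hi using hv
    obtain rfl : v = fun j => f (i j) := funext fun j => (hi j).symm
    obtain ⟨C, hC⟩ := (Metric.isBounded_range_of_tendsto _ hvl).subset_closedBall 0
    refine hlim (fun j x => (f (i j) x : ℝ)) _ C (fun n => isBPos_boundedContinuous _)
      (fun n => hKl.mono fun s hs => hs _) (fun n x => ?_) fun x => ?_
    · have h1 : dist (f (i n)) 0 ≤ C := hC ⟨n, rfl⟩
      have h2 := BoundedContinuousFunction.dist_coe_le_dist (f := f (i n)) (g := 0) x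
      have h3 : dist (f (i n) x) 0 = (f (i n) x : ℝ) := by
        rw [NNReal.dist_eq]; simp
      have h4 : dist (f (i n) x) 0 ≤ dist (f (i n)) 0 := h2
      linarith
    · exact NNReal.tendsto_coe.2
        ((BoundedContinuousFunction.tendsto_iff_tendstoUniformly.1 hvl).tendsto_at x)
  refine ⟨fun s => (K s).map fun ν => ν.comap φ, fun s => ?_, fun g hg => ?_⟩
  · have := hKp s
    exact Measure.isProbabilityMeasure_map (measurable_finiteMeasure_comap hφ).aemeasurable
  · filter_upwards [hall _ (isBPos_extend hφ hg)] with s hs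
    rw [laplace_map_comap hφ hg, hs]
    congr 1
    funext x
    exact hφ.injective.extend_apply g 0 x

end IsLaplaceLimit

end Existence

/-! ### The measure associated with a monotone function -/

section Stieltjes

variable {F G : ℝ → ℝ}

/-- The Lebesgue–Stieltjes measure of a monotone function that need not be right continuous. -/
noncomputable def lsMeasure (hG : Monotone G) : Measure ℝ := hG.stieltjesFunction.measure

instance (hG : Monotone G) : IsLocallyFiniteMeasure (lsMeasure hG) := by
  unfold lsMeasure; infer_instance

lemma leftLim_rightLim_eq (hG : Monotone G) (a : ℝ) :
    Function.leftLim (Function.rightLim G) a = Function.leftLim G a :=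
  leftLim_rightLim (hG.tendsto_leftLim a)

lemma lsMeasure_Ioc (hG : Monotone G) (a b : ℝ) :
    lsMeasure hG (Set.Ioc a b) = ENNReal.ofReal (Function.rightLim G b - Function.rightLim G a) :=
  StieltjesFunction.measure_Ioc _ a b

lemma lsMeasure_singleton (hG : Monotone G) (a : ℝ) :
    lsMeasure hG {a} = ENNReal.ofReal (Function.rightLim G a - Function.leftLim G a) := by
  rw [lsMeasure, StieltjesFunction.measure_singleton, ← leftLim_rightLim_eq hG]
  rfl

lemma lsMeasure_Ioo (hG : Monotone G) (a b : ℝ) :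
    lsMeasure hG (Set.Ioo a b) =
      ENNReal.ofReal (Function.leftLim G b - Function.rightLim G a) := by
  rw [lsMeasure, StieltjesFunction.measure_Ioo, ← leftLim_rightLim_eq hG]
  rfl

lemma lsMeasure_singleton_of_continuousAt (hG : Monotone G) {a : ℝ} (ha : ContinuousAt G a) :
    lsMeasure hG {a} = 0 := by
  rw [lsMeasure_singleton, (hG.continuousAt_iff_leftLim_eq_rightLim.1 ha), sub_self,
    ENNReal.ofReal_zero]

lemma lsMeasure_Icc_of_continuousAt (hG : Monotone G) {a b : ℝ} (ha : ContinuousAt G a)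
    (hb : ContinuousAt G b) : lsMeasure hG (Set.Icc a b) = ENNReal.ofReal (G b - G a) := by
  rw [lsMeasure, StieltjesFunction.measure_Icc]
  congr 2
  · exact (hb.continuousWithinAt).rightLim_eq
  · change Function.leftLim (Function.rightLim G) a = _
    rw [leftLim_rightLim_eq hG]
    exact (ha.continuousWithinAt).leftLim_eq

lemma lsMeasure_Icc_le (hG : Monotone G) {a b c d : ℝ} (hca : c < a) (hbd : b < d) :
    lsMeasure hG (Set.Icc a b) ≤ ENNReal.ofReal (G d - G c) := by
  rw [lsMeasure, StieltjesFunction.measure_Icc]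
  refine ENNReal.ofReal_le_ofReal (sub_le_sub (hG.rightLim_le hbd) ?_)
  change _ ≤ Function.leftLim (Function.rightLim G) a
  rw [leftLim_rightLim_eq hG]
  exact hG.le_leftLim hca

lemma rightLim_add (hF : Monotone F) (hG : Monotone G) (a : ℝ) :
    Function.rightLim (fun x => F x + G x) a = Function.rightLim F a + Function.rightLim G a :=
  rightLim_eq_of_tendsto ((hF.tendsto_rightLim a).add (hG.tendsto_rightLim a))

lemma lsMeasure_add (hF : Monotone F) (hG : Monotone G) :
    lsMeasure (hF.add hG) = lsMeasure hF + lsMeasure hG := by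
  unfold lsMeasure
  rw [← StieltjesFunction.measure_add]
  congr 1
  ext x
  exact rightLim_add hF hG x

lemma lsMeasure_mono (hF : Monotone F) (hG : Monotone G) (hFG : Monotone fun x => G x - F x) :
    lsMeasure hF ≤ lsMeasure hG := by
  have h := lsMeasure_add hF hFG
  have h' : lsMeasure (hF.add hFG) = lsMeasure hG := by
    congr 1
    funext x
    simp
  rw [← h', h]
  exact Measure.le_add_right le_rfl

lemma lsMeasure_natCast_mul (hG : Monotone G) (n : ℕ) (h : Monotone fun x => (n : ℝ) * G x) :
    lsMeasure h = n • lsMeasure hG := by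
  induction n with
  | zero =>
    have : h.stieltjesFunction = StieltjesFunction.const ℝ 0 := by
      ext x
      change Function.rightLim (fun x => ((0 : ℕ) : ℝ) * G x) x = 0
      refine rightLim_eq_of_tendsto ?_
      simp
    rw [lsMeasure, this, StieltjesFunction.measure_const, zero_smul]
  | succ n ih =>
    have hn : Monotone fun x => (n : ℝ) * G x := hG.const_mul n.cast_nonneg
    rw [succ_nsmul, ← ih hn, ← lsMeasure_add hn hG]
    congr 1
    funext x
    push_cast
    ring

/-- The measure on a half-line depends only on the function there, up to an additive constant. -/
lemma lsMeasure_restrict_Iio_congr (hF : Monotone F) (hG : Monotone G) {q c : ℝ}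
    (h : ∀ x < q, F x = G x + c) :
    (lsMeasure hF).restrict (Set.Iio q) = (lsMeasure hG).restrict (Set.Iio q) := by
  have hr : ∀ a < q, Function.rightLim F a = Function.rightLim G a + c := by
    intro a ha
    refine rightLim_eq_of_tendsto (((hG.tendsto_rightLim a).add_const c).congr' ?_)
    filter_upwards [nhdsWithin_le_nhds (Iio_mem_nhds ha)] with x hx using (h x hx).symm
  have hl : ∀ a ≤ q, Function.leftLim F a = Function.leftLim G a + c := by
    intro a ha
    refine leftLim_eq_of_tendsto (((hG.tendsto_leftLim a).add_const c).congr' ?_)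
    filter_upwards [self_mem_nhdsWithin] with x hx using (h x (lt_of_lt_of_le hx ha)).symm
  refine Real.measure_ext_Ioo_rat fun a b => ?_
  rw [Measure.restrict_apply measurableSet_Ioo, Measure.restrict_apply measurableSet_Ioo,
    Set.Ioo_inter_Iio, lsMeasure_Ioo, lsMeasure_Ioo]
  rcases lt_or_ge (a : ℝ) q with ha | ha
  · rw [hr _ ha, hl _ (min_le_right _ _)]
    congr 1
    ring
  · have hle : min (b : ℝ) q ≤ a := (min_le_right _ _).trans ha
    rw [ENNReal.ofReal_eq_zero.2 (sub_nonpos.2 (hF.leftLim_le_rightLim hle)),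
      ENNReal.ofReal_eq_zero.2 (sub_nonpos.2 (hG.leftLim_le_rightLim hle))]

lemma lsMeasure_Ioi_eq_zero (hG : Monotone G) {t : ℝ} (h : ∀ x, t ≤ x → G x = G t) :
    lsMeasure hG (Set.Ioi t) = 0 := by
  have hr : ∀ a, t ≤ a → Function.rightLim G a = G t := by
    intro a ha
    refine rightLim_eq_of_tendsto (tendsto_const_nhds.congr' ?_)
    filter_upwards [self_mem_nhdsWithin] with x hx using (h x (ha.trans (le_of_lt hx))).symm
  have hU : Set.Ioi t = ⋃ n : ℕ, Set.Ioc t (t + n) := by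
    ext x
    simp only [Set.mem_Ioi, Set.mem_iUnion, Set.mem_Ioc]
    refine ⟨fun hx => ?_, fun ⟨_, hx, _⟩ => hx⟩
    obtain ⟨n, hn⟩ := exists_nat_ge (x - t)
    exact ⟨n, hx, by linarith⟩
  rw [hU, measure_iUnion_null_iff]
  intro n
  rw [lsMeasure_Ioc, hr _ le_rfl, hr _ (by linarith [n.cast_nonneg (α := ℝ)]), sub_self,
    ENNReal.ofReal_zero]

end Stieltjes

/-! ### Cumulant semigroups and entrance laws -/

section Cumulant

variable {E : Type u} [TopologicalSpace E] [MeasurableSpace E]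
  {Q : ℝ → ℝ → Kernel (FiniteMeasure E) (FiniteMeasure E)} {f g : E → ℝ} {r s t : ℝ}

namespace IsMBSemigroup

lemma isBPos_cumulant (hQ : IsMBSemigroup Q) (hrt : r ≤ t) (hf : IsBPos f) :
    IsBPos (cumulant Q r t f) := by
  have := hQ.markov r t hrt
  refine ⟨?_, fun x => lexp_nonneg hf, ?_⟩
  · exact (hQ.measurable_cumulant r t hrt f hf).comp
      (measurable_prodMk_left (x := (⟨r, le_rfl, hrt⟩ : Set.Icc r t)))
  · obtain ⟨C, hC⟩ := hQ.bounded_cumulant r t hrt f hf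
    exact ⟨C, fun x => (le_abs_self _).trans (hC r ⟨le_rfl, hrt⟩ x)⟩

lemma laplace_comp (hQ : IsMBSemigroup Q) (hrt : r ≤ t) (hf : IsBPos f)
    (F : Measure (FiniteMeasure E)) [IsProbabilityMeasure F] :
    laplace (Q r t ∘ₘ F) f = laplace F (cumulant Q r t f) := by
  have := hQ.markov r t hrt
  have h : ∫ ν, Real.exp (-∫ x, f x ∂(ν : Measure E)) ∂(Q r t ∘ₘ F) =
      ∫ μ, ∫ ν, Real.exp (-∫ x, f x ∂(ν : Measure E)) ∂(Q r t μ) ∂F := by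
    rw [Measure.comp_eq_comp_const_apply, Kernel.integral_comp]
    · simp
    · rw [← Measure.comp_eq_comp_const_apply]
      exact integrable_exp_neg_integral hf _
  rw [laplace, h]
  exact integral_congr_ae (ae_of_all _ fun μ => hQ.branching r t hrt μ f hf)

lemma lexp_comp (hQ : IsMBSemigroup Q) (hrt : r ≤ t) (hf : IsBPos f)
    (F : Measure (FiniteMeasure E)) [IsProbabilityMeasure F] :
    lexp (Q r t ∘ₘ F) f = lexp F (cumulant Q r t f) := by
  rw [lexp, hQ.laplace_comp hrt hf, lexp]

lemma isProbabilityMeasure_comp (hQ : IsMBSemigroup Q) (hrt : r ≤ t)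
    (F : Measure (FiniteMeasure E)) [IsProbabilityMeasure F] :
    IsProbabilityMeasure (Q r t ∘ₘ F) := by
  have := hQ.markov r t hrt
  infer_instance

lemma comp_self (hQ : IsMBSemigroup Q) (F : Measure (FiniteMeasure E)) : Q t t ∘ₘ F = F := by
  rw [hQ.refl t, Measure.id_comp]

lemma comp_comp (hQ : IsMBSemigroup Q) (hrs : r ≤ s) (hst : s ≤ t)
    (F : Measure (FiniteMeasure E)) : Q s t ∘ₘ (Q r s ∘ₘ F) = Q r t ∘ₘ F := by
  rw [Measure.comp_assoc, hQ.chapman_kolmogorov r s t hrs hst]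

lemma cumulant_self (hQ : IsMBSemigroup Q) (hf : IsBPos f) : cumulant Q t t f = f := by
  funext x
  rw [cumulant, hQ.refl t, Kernel.id_apply, laplace_dirac _ hf, Real.log_exp, neg_neg]
  exact integral_dirac' f x hf.1.stronglyMeasurable

lemma cumulant_mono (hQ : IsMBSemigroup Q) (hrt : r ≤ t) (hf : IsBPos f) (hg : IsBPos g)
    (hfg : ∀ x, f x ≤ g x) (x : E) : cumulant Q r t f x ≤ cumulant Q r t g x := by
  have := hQ.markov r t hrt
  exact lexp_mono hf hg hfg

lemma cumulant_natCast_mul_le (hQ : IsMBSemigroup Q) (hrt : r ≤ t) (hf : IsBPos f) (n : ℕ) (x : E) :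
    cumulant Q r t (fun x => n * f x) x ≤ n * cumulant Q r t f x := by
  have := hQ.markov r t hrt
  exact lexp_natCast_mul_le hf n

end IsMBSemigroup

lemma IsProbEntranceLaw.comp_eq {K : ℝ → Measure (FiniteMeasure E)} {α : ℝ}
    (hQ : IsMBSemigroup Q) (hK : IsProbEntranceLaw Q α K) (hr : α < r) (hrt : r ≤ t) :
    Q r t ∘ₘ K r = K t := by
  rcases hrt.eq_or_lt with rfl | hlt
  · exact hQ.comp_self _
  · exact hK.entrance r t hr hlt

lemma IsProbEntranceLaw.lexp_eq {K : ℝ → Measure (FiniteMeasure E)} {α : ℝ}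
    (hQ : IsMBSemigroup Q) (hK : IsProbEntranceLaw Q α K) (hr : α < r) (hrt : r ≤ t)
    (hf : IsBPos f) : lexp (K r) (cumulant Q r t f) = lexp (K t) f := by
  have := hK.prob r hr
  rw [← hK.comp_eq hQ hr hrt, hQ.lexp_comp hrt hf]

lemma IsClosedProbEntranceLaw.lexp_eq {K : ℝ → Measure (FiniteMeasure E)} {α : ℝ}
    (hQ : IsMBSemigroup Q) (hK : IsClosedProbEntranceLaw Q α K) (hr : α ≤ r) (hrt : r ≤ t)
    (hf : IsBPos f) : lexp (K r) (cumulant Q r t f) = lexp (K t) f := by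
  rcases hr.eq_or_lt with rfl | hr
  · have := hK.prob_initial
    rcases hrt.eq_or_lt with rfl | hrt
    · rw [hQ.cumulant_self hf]
    · rw [hK.closed t hrt, hQ.lexp_comp hrt.le hf]
  · exact hK.toIsProbEntranceLaw.lexp_eq hQ hr hrt hf

end Cumulant

/-! ### Skew convolution semigroups as monotone functions -/

/-- A function that is constant on `[t, ∞)` is monotone if its increments on `(-∞, t]` are
nonnegative. -/
lemma monotone_of_le_of_ge {G : ℝ → ℝ} {t : ℝ}
    (h1 : ∀ r s, r ≤ s → s ≤ t → G r ≤ G s)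
    (h2 : ∀ r, t ≤ r → G r = G t) : Monotone G := by
  intro r s hrs
  rcases le_total s t with hs | hs
  · exact h1 r s hrs hs
  · rw [h2 s hs]
    rcases le_total r t with hr | hr
    · exact h1 r t hr le_rfl
    · rw [h2 r hr]

/-- The function `r ↦ log L_{N_{r,t}}(f)` on `(-∞, t]`, extended to `ℝ` by its value `0` at `t`. -/
noncomputable def scFun {E : Type u} [MeasurableSpace E]
    (N : ℝ → ℝ → Measure (FiniteMeasure E)) (t : ℝ) (f : E → ℝ) (r : ℝ) : ℝ :=
  -lexp (N (min r t) t) f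

lemma scFun_of_le {E : Type u} [MeasurableSpace E] {N : ℝ → ℝ → Measure (FiniteMeasure E)}
    {f : E → ℝ} {r t : ℝ} (hrt : r ≤ t) : scFun N t f r = -lexp (N r t) f := by
  rw [scFun, min_eq_left hrt]

section Skew

variable {E : Type u} [TopologicalSpace E] [MeasurableSpace E]
  {Q : ℝ → ℝ → Kernel (FiniteMeasure E) (FiniteMeasure E)}
  {N : ℝ → ℝ → Measure (FiniteMeasure E)} {f g : E → ℝ} {r s t : ℝ}

/-- A skew convolution semigroup of probability measures associated with the transition semigroup of
a measure-valued branching process. -/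
structure IsProbSC (Q : ℝ → ℝ → Kernel (FiniteMeasure E) (FiniteMeasure E))
    (N : ℝ → ℝ → Measure (FiniteMeasure E)) : Prop where
  semigroup : IsMBSemigroup Q
  prob : ∀ r t, r ≤ t → IsProbabilityMeasure (N r t)
  skew : IsSCSemigroup Q N

namespace IsProbSC

lemma lexp_eq (h : IsProbSC Q N) (hrs : r ≤ s) (hst : s ≤ t) (hf : IsBPos f) :
    lexp (N r t) f = lexp (N r s) (cumulant Q s t f) + lexp (N s t) f := by
  have := h.prob r s hrs
  have := h.prob s t hst
  have := h.semigroup.markov s t hst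
  rw [h.skew r s t hrs hst, lexp_conv hf, h.semigroup.lexp_comp hst hf]

lemma lexp_self (h : IsProbSC Q N) (hf : IsBPos f) : lexp (N t t) f = 0 := by
  have h1 := h.lexp_eq le_rfl le_rfl hf (r := t) (s := t) (t := t)
  rw [h.semigroup.cumulant_self hf] at h1
  linarith

lemma scFun_of_ge (h : IsProbSC Q N) (htr : t ≤ r) (hf : IsBPos f) : scFun N t f r = 0 := by
  rw [scFun, min_eq_right htr, h.lexp_self hf, neg_zero]

lemma scFun_sub (h : IsProbSC Q N) (hrs : r ≤ s) (hst : s ≤ t) (hf : IsBPos f) :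
    scFun N t f s - scFun N t f r = lexp (N r s) (cumulant Q s t f) := by
  rw [scFun_of_le hst, scFun_of_le (hrs.trans hst), h.lexp_eq hrs hst hf]
  ring

lemma scFun_eq_add (h : IsProbSC Q N) (hrs : r ≤ s) (hst : s ≤ t) (hf : IsBPos f) :
    scFun N t f r = scFun N s (cumulant Q s t f) r + scFun N t f s := by
  have := h.scFun_sub hrs hst hf
  rw [scFun_of_le hrs]
  linarith

lemma rightLim_scFun_self (h : IsProbSC Q N) (hf : IsBPos f) :
    Function.rightLim (scFun N t f) t = 0 := by
  refine rightLim_eq_of_tendsto (tendsto_const_nhds.congr' ?_)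
  filter_upwards [self_mem_nhdsWithin] with x hx
  rw [h.scFun_of_ge (le_of_lt hx) hf]

lemma monotone_scFun (h : IsProbSC Q N) (hf : IsBPos f) : Monotone (scFun N t f) := by
  refine monotone_of_le_of_ge (t := t) (fun r s hrs hst => ?_) fun r hr => ?_
  · have := h.prob r s hrs
    have h1 := h.scFun_sub hrs hst hf
    have h2 := lexp_nonneg (F := N r s) (h.semigroup.isBPos_cumulant hst hf)
    linarith
  · rw [h.scFun_of_ge hr hf, h.scFun_of_ge le_rfl hf]

lemma monotone_scFun_sub (h : IsProbSC Q N) (hf : IsBPos f) (hg : IsBPos g) (hfg : ∀ x, f x ≤ g x) :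
    Monotone fun r => scFun N t g r - scFun N t f r := by
  refine monotone_of_le_of_ge (t := t) (fun r s hrs hst => ?_) fun r hr => ?_
  · have := h.prob r s hrs
    have h1 := h.scFun_sub hrs hst hf
    have h2 := h.scFun_sub hrs hst hg
    have h3 := lexp_mono (F := N r s) (h.semigroup.isBPos_cumulant hst hf)
      (h.semigroup.isBPos_cumulant hst hg) (h.semigroup.cumulant_mono hst hf hg hfg)
    linarith
  · rw [h.scFun_of_ge hr hf, h.scFun_of_ge le_rfl hf, h.scFun_of_ge hr hg, h.scFun_of_ge le_rfl hg]

/-- The increments of `scFun N t f` are dominated by a multiple of those of `scFun N t 1`. -/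
lemma monotone_natCast_mul_scFun_sub (h : IsProbSC Q N) (hf : IsBPos f) {n : ℕ}
    (hn : ∀ x, f x ≤ n) :
    Monotone fun r => n * scFun N t (fun _ => 1) r - scFun N t f r := by
  have h1B : IsBPos (fun _ : E => (1 : ℝ)) := IsBPos.const zero_le_one
  refine monotone_of_le_of_ge (t := t) (fun r s hrs hst => ?_) fun r hr => ?_
  · have := h.prob r s hrs
    have hV1 := h.semigroup.isBPos_cumulant hst h1B
    have hVf := h.semigroup.isBPos_cumulant hst hf
    have h1 := h.scFun_sub hrs hst hf
    have h2 := h.scFun_sub hrs hst h1B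
    have h3 : lexp (N r s) (cumulant Q s t f) ≤
        lexp (N r s) (fun x => n * cumulant Q s t (fun _ => 1) x) := by
      refine lexp_mono hVf (hV1.const_mul n.cast_nonneg) fun x => ?_
      refine le_trans ?_ (h.semigroup.cumulant_natCast_mul_le hst h1B n x)
      exact h.semigroup.cumulant_mono hst hf (h1B.const_mul n.cast_nonneg) (by simpa using hn) x
    have h4 := lexp_natCast_mul_le (F := N r s) hV1 n
    rw [← h1] at h3
    rw [← h2] at h4
    linarith
  · rw [h.scFun_of_ge hr hf, h.scFun_of_ge le_rfl hf, h.scFun_of_ge hr h1B,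
      h.scFun_of_ge le_rfl h1B]

end IsProbSC

end Skew

/-! ### The jumps: entrance laws at the discontinuity points -/

/-- The points at which one of the functions `scFun N q 1`, with `q` rational, is discontinuous. -/
def jumpSet {E : Type u} [MeasurableSpace E]
    (N : ℝ → ℝ → Measure (FiniteMeasure E)) : Set ℝ :=
  ⋃ q : ℚ, {s | ¬ContinuousAt (scFun N q fun _ => 1) s}

lemma continuousAt_of_notMem_jumpSet {E : Type u} [MeasurableSpace E]
    {N : ℝ → ℝ → Measure (FiniteMeasure E)} {s : ℝ} (hs : s ∉ jumpSet N) (q : ℚ) :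
    ContinuousAt (scFun N q fun _ => 1) s := by
  by_contra hc
  exact hs (Set.mem_iUnion.2 ⟨q, hc⟩)

lemma IsProbSC.countable_jumpSet {E : Type u} [TopologicalSpace E] [MeasurableSpace E]
    {Q : ℝ → ℝ → Kernel (FiniteMeasure E) (FiniteMeasure E)}
    {N : ℝ → ℝ → Measure (FiniteMeasure E)} (h : IsProbSC Q N) : (jumpSet N).Countable :=
  Set.countable_iUnion fun _ =>
    (h.monotone_scFun (IsBPos.const zero_le_one)).countable_not_continuousAt

section Jumps

variable {E : Type u} [TopologicalSpace E] [LusinTopologicalSpace E] [MeasurableSpace E]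
  [BorelSpace E] {Q : ℝ → ℝ → Kernel (FiniteMeasure E) (FiniteMeasure E)}
  {N : ℝ → ℝ → Measure (FiniteMeasure E)} {f g : E → ℝ} {r s t : ℝ}

/-- A pointwise limit of Laplace exponents dominated by a Laplace exponent is one itself. -/
lemma exists_lexp_eq_of_tendsto {F : ℕ → Measure (FiniteMeasure E)}
    (hF : ∀ n, IsProbabilityMeasure (F n)) {F₀ : Measure (FiniteMeasure E)}
    [IsProbabilityMeasure F₀] {v : (E → ℝ) → ℝ}
    (hv : ∀ f, IsBPos f → Tendsto (fun n => lexp (F n) f) atTop (𝓝 (v f)))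
    (hle : ∀ f, IsBPos f → v f ≤ lexp F₀ f) :
    ∃ K : Measure (FiniteMeasure E), IsProbabilityMeasure K ∧ ∀ f, IsBPos f → lexp K f = v f := by
  have hlap : ∀ f, IsBPos f →
      Tendsto (fun n => laplace (F n) f) atTop (𝓝 (Real.exp (-v f))) := by
    intro f hf
    refine ((Real.continuous_exp.tendsto _).comp (hv f hf).neg).congr fun n => ?_
    have := hF n
    exact exp_neg_lexp hf
  have hu : IsLaplaceLimit (Measure.dirac ()) (fun (f : E → ℝ) (_ : Unit) => Real.exp (-v f)) := by
    refine ⟨fun fs hfs => ae_of_all _ fun _ => ⟨F, hF, fun i => hlap _ (hfs i)⟩,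
      fun fs hfs hanti hlim => ae_of_all _ fun _ => ?_⟩
    obtain ⟨m, -, hm⟩ := (hfs 0).exists_nat_bound
    have h1 := tendsto_laplace (F := F₀) (f := fun _ => 0) hfs (C := m)
      (fun n x => (hanti x n.zero_le).trans (hm x)) hlim
    rw [laplace_zero] at h1
    refine tendsto_of_tendsto_of_tendsto_of_le_of_le h1 tendsto_const_nhds (fun n => ?_) fun n => ?_
    · rw [← exp_neg_lexp (hfs n)]
      exact Real.exp_le_exp.2 (neg_le_neg (hle _ (hfs n)))
    · refine le_of_tendsto' (hlap _ (hfs n)) fun k => ?_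
      have := hF k
      exact laplace_le_one (hfs n)
  obtain ⟨K, hK, hKl⟩ := hu.exists_laplace_eq
  refine ⟨K (), hK (), fun f hf => ?_⟩
  have h1 : ∀ᵐ s ∂Measure.dirac (), laplace (K s) f = Real.exp (-v f) := hKl f hf
  rw [ae_dirac_eq] at h1
  have h2 : laplace (K ()) f = Real.exp (-v f) := h1
  rw [lexp, h2, Real.log_exp, neg_neg]

namespace IsProbSC

/-- The right jump at `s` of `scFun N t f`, as a function of `t > s`, is given by an entrance
law at `s`: the limit of the laws `N_{s,u} Q_{u,t}` as `u ↓ s`. -/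
theorem exists_entranceLaw (h : IsProbSC Q N) (s : ℝ) :
    ∃ K : ℝ → Measure (FiniteMeasure E), IsProbEntranceLaw Q s K ∧ ∀ t, s < t → ∀ f, IsBPos f →
      lexp (K t) f = Function.rightLim (scFun N t f) s - scFun N t f s := by
  have hex : ∀ t, s < t → ∃ K : Measure (FiniteMeasure E), IsProbabilityMeasure K ∧
      ∀ f, IsBPos f → lexp K f = Function.rightLim (scFun N t f) s - scFun N t f s := by
    intro t hst
    obtain ⟨v, -, hv, hvlim⟩ := exists_seq_strictAnti_tendsto' hst
    have hprob := fun n => h.prob s (v n) (hv n).1.le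
    have := h.prob s t hst.le
    refine exists_lexp_eq_of_tendsto (F := fun n => Q (v n) t ∘ₘ N s (v n)) (F₀ := N s t)
      (fun n => h.semigroup.isProbabilityMeasure_comp (hv n).2.le _) (fun f hf => ?_)
      fun f hf => ?_
    · have h1 : Tendsto v atTop (𝓝[>] s) :=
        tendsto_nhdsWithin_iff.2 ⟨hvlim, .of_forall fun n => (hv n).1⟩
      refine ((((h.monotone_scFun hf).tendsto_rightLim s).comp h1).sub_const _).congr fun n => ?_
      rw [h.semigroup.lexp_comp (hv n).2.le hf, ← h.scFun_sub (hv n).1.le (hv n).2.le hf]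
      rfl
    · have h1 := (h.monotone_scFun hf (t := t)).rightLim_le hst
      rw [h.scFun_of_ge le_rfl hf] at h1
      rw [scFun_of_le hst.le]
      linarith
  choose! K hKp hK using hex
  refine ⟨K, ⟨hKp, fun r t hsr hrt => ?_⟩, hK⟩
  have := hKp r hsr
  have := hKp t (hsr.trans hrt)
  have := h.semigroup.isProbabilityMeasure_comp hrt.le (K r)
  have := countablyGenerated_of_lusin E
  refine laplace_ext fun f hf => ?_
  rw [← exp_neg_lexp hf, ← exp_neg_lexp hf, h.semigroup.lexp_comp hrt.le hf,
    hK r hsr _ (h.semigroup.isBPos_cumulant hrt.le hf), hK t (hsr.trans hrt) f hf]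
  congr 2
  have h1 : Function.rightLim (scFun N t f) s =
      Function.rightLim (scFun N r (cumulant Q r t f)) s + scFun N t f r := by
    refine rightLim_eq_of_tendsto
      ((((h.monotone_scFun (h.semigroup.isBPos_cumulant hrt.le hf)).tendsto_rightLim s).add_const
        (scFun N t f r)).congr' ?_)
    filter_upwards [nhdsWithin_le_nhds (Iio_mem_nhds hsr)] with x hx
    exact (h.scFun_eq_add (le_of_lt hx) hrt.le hf).symm
  rw [h1, h.scFun_eq_add hsr.le hrt.le hf]
  ring

/-- The left jump at `s` of `scFun N t f`, as a function of `t ≥ s`, is given by a closed entrance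
law at `s`, started from the limit of the laws `N_{u,s}` as `u ↑ s`. -/
theorem exists_closedEntranceLaw (h : IsProbSC Q N) (s : ℝ) :
    ∃ K : ℝ → Measure (FiniteMeasure E), IsClosedProbEntranceLaw Q s K ∧
      ∀ t, s ≤ t → ∀ f, IsBPos f →
        lexp (K t) f = scFun N t f s - Function.leftLim (scFun N t f) s := by
  obtain ⟨v, -, hv, hvlim⟩ := exists_seq_strictMono_tendsto' (show s - 1 < s by linarith)
  have hprob := fun n => h.prob (v n) s (hv n).2.le
  have := h.prob (s - 1) s (by linarith)
  obtain ⟨K₀, hK₀, hK⟩ := exists_lexp_eq_of_tendsto (F := fun n => N (v n) s) (F₀ := N (s - 1) s)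
    (v := fun f => -Function.leftLim (scFun N s f) s) hprob (fun f hf => by
      have h1 : Tendsto v atTop (𝓝[<] s) :=
        tendsto_nhdsWithin_iff.2 ⟨hvlim, .of_forall fun n => (hv n).2⟩
      refine (((h.monotone_scFun hf).tendsto_leftLim s).comp h1).neg.congr fun n => ?_
      rw [Function.comp_apply, scFun_of_le (hv n).2.le, neg_neg])
    (fun f hf => by
      have h1 := (h.monotone_scFun hf (t := s)).le_leftLim (show s - 1 < s by linarith)
      rw [scFun_of_le (by linarith)] at h1
      linarith)
  refine ⟨fun t => Q s t ∘ₘ K₀, ⟨⟨fun t hst => h.semigroup.isProbabilityMeasure_comp hst.le _,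
    fun r t hsr hrt => h.semigroup.comp_comp hsr.le hrt.le _⟩, ?_, fun t _ => ?_⟩,
    fun t hst f hf => ?_⟩
  · rw [h.semigroup.comp_self]
    exact hK₀
  · rw [h.semigroup.comp_self]
  · have hV := h.semigroup.isBPos_cumulant hst hf
    have h1 : Function.leftLim (scFun N t f) s =
        Function.leftLim (scFun N s (cumulant Q s t f)) s + scFun N t f s := by
      refine leftLim_eq_of_tendsto
        ((((h.monotone_scFun hV).tendsto_leftLim s).add_const (scFun N t f s)).congr' ?_)
      filter_upwards [self_mem_nhdsWithin] with x hx
      exact (h.scFun_eq_add (le_of_lt hx) hst hf).symm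
    rw [h.semigroup.lexp_comp hst hf, hK _ hV, h1]
    ring

lemma rightLim_eq_of_notMem_jumpSet (h : IsProbSC Q N) (hs : s ∉ jumpSet N) (hst : s < t)
    (hf : IsBPos f) : Function.rightLim (scFun N t f) s = scFun N t f s := by
  obtain ⟨K, hK, hKl⟩ := h.exists_entranceLaw s
  obtain ⟨q, hsq, hqt⟩ := exists_rat_btwn hst
  have := hK.prob q hsq
  have h1 : lexp (K q) (fun _ => 1) = 0 := by
    rw [hKl q hsq _ (IsBPos.const zero_le_one),
      (continuousAt_of_notMem_jumpSet hs q).continuousWithinAt.rightLim_eq, sub_self]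
  have h2 : lexp (K t) f = 0 := by
    rw [← hK.lexp_eq h.semigroup hsq hqt.le hf]
    exact lexp_eq_zero_of_one h1 (h.semigroup.isBPos_cumulant hqt.le hf)
  rw [hKl t hst f hf] at h2
  linarith

/-- Right continuity of the cumulant semigroup rules out left jumps outside `jumpSet N`:
a nontrivial closed entrance law is nontrivial at some rational time. -/
lemma leftLim_eq_of_notMem_jumpSet (h : IsProbSC Q N) (hs : s ∉ jumpSet N) (hst : s ≤ t)
    (hf : IsBPos f) : Function.leftLim (scFun N t f) s = scFun N t f s := by
  obtain ⟨K, hK, hKl⟩ := h.exists_closedEntranceLaw s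
  have h1B : IsBPos (fun _ : E => (1 : ℝ)) := IsBPos.const zero_le_one
  have := hK.prob_initial
  have hq : ∀ n : ℕ, ∃ q : ℚ, s < q ∧ (q : ℝ) < s + 1 / ((n : ℝ) + 1) := fun n =>
    exists_rat_btwn (lt_add_of_pos_right s (by positivity))
  choose q hsq hqn using hq
  have hqlim : Tendsto (fun n => (q n : ℝ)) atTop (𝓝 s) := by
    refine tendsto_of_tendsto_of_tendsto_of_le_of_le tendsto_const_nhds ?_
      (fun n => (hsq n).le) (fun n => (hqn n).le)
    simpa using (tendsto_one_div_add_atTop_nhds_zero_nat (𝕜 := ℝ)).const_add s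
  have hV : ∀ n, IsBPos (cumulant Q s (q n) fun _ => 1) := fun n =>
    h.semigroup.isBPos_cumulant (hsq n).le h1B
  have hVlim : ∀ x, Tendsto (fun n => cumulant Q s (q n) (fun _ => 1) x) atTop (𝓝 1) := by
    intro x
    have h1 := h.semigroup.right_continuous_cumulant _ h1B continuous_const s s le_rfl x
    have h2 : Tendsto (fun n => (q n : ℝ)) atTop (𝓝[≥] s) :=
      tendsto_nhdsWithin_iff.2 ⟨hqlim, .of_forall fun n => (hsq n).le⟩
    have h3 := h1.tendsto.comp h2
    rwa [h.semigroup.cumulant_self h1B] at h3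
  let g : ℕ → E → ℝ := fun n x => min (cumulant Q s (q n) (fun _ => 1) x) 1
  have hg : ∀ n, IsBPos (g n) := fun n => ⟨(hV n).1.min measurable_const,
    fun x => le_min ((hV n).2.1 x) zero_le_one, 1, fun x => min_le_right _ _⟩
  have hzero : ∀ n, lexp (K s) (g n) = 0 := by
    intro n
    refine le_antisymm ?_ (lexp_nonneg (hg n))
    refine (lexp_mono (hg n) (hV n) fun x => min_le_left _ _).trans ?_
    rw [hK.lexp_eq h.semigroup le_rfl (hsq n).le h1B, hKl _ (hsq n).le _ h1B,
      (continuousAt_of_notMem_jumpSet hs (q n)).continuousWithinAt.leftLim_eq, sub_self]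
  have hone : laplace (K s) (fun _ => 1) = 1 := by
    have h1 := tendsto_laplace (F := K s) hg (f := fun _ => 1) (C := 1)
      (fun n x => min_le_right _ _) fun x => by
        simpa using (hVlim x).min (tendsto_const_nhds (x := (1 : ℝ)))
    refine tendsto_nhds_unique h1 (tendsto_const_nhds.congr fun n => ?_)
    rw [← exp_neg_lexp (hg n), hzero n, neg_zero, Real.exp_zero]
  have h2 : lexp (K t) f = 0 := by
    rw [← hK.lexp_eq h.semigroup le_rfl hst hf]
    refine lexp_eq_zero_of_one ?_ (h.semigroup.isBPos_cumulant hst hf)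
    rw [lexp, hone, Real.log_one, neg_zero]
  rw [hKl t hst f hf] at h2
  linarith

lemma continuousAt_scFun (h : IsProbSC Q N) (hs : s ∉ jumpSet N) (t : ℝ) (hf : IsBPos f) :
    ContinuousAt (scFun N t f) s := by
  rcases le_or_gt s t with hst | hst
  · refine (h.monotone_scFun hf).continuousAt_iff_leftLim_eq_rightLim.2 ?_
    rw [h.leftLim_eq_of_notMem_jumpSet hs hst hf]
    rcases hst.eq_or_lt with rfl | hst
    · rw [h.rightLim_scFun_self hf, h.scFun_of_ge le_rfl hf]
    · rw [h.rightLim_eq_of_notMem_jumpSet hs hst hf]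
  · refine (continuousAt_const (y := (0 : ℝ))).congr ?_
    filter_upwards [Ioi_mem_nhds hst] with x hx
    exact (h.scFun_of_ge (le_of_lt hx) hf).symm

end IsProbSC

end Jumps

/-! ### The measures of increments and a dominating diffuse measure -/

section Increments

variable {E : Type u} [MeasurableSpace E]

open Classical in
/-- The Lebesgue–Stieltjes measure of `r ↦ log L_{N_{r,t}}(f)` (zero if `scFun N t f` is not
monotone, which does not happen for the families considered here). -/
noncomputable def scMeasure (N : ℝ → ℝ → Measure (FiniteMeasure E)) (t : ℝ) (f : E → ℝ) :
    Measure ℝ :=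
  if hG : Monotone (scFun N t f) then lsMeasure hG else 0

instance (N : ℝ → ℝ → Measure (FiniteMeasure E)) (t : ℝ) (f : E → ℝ) :
    IsLocallyFiniteMeasure (scMeasure N t f) := by
  unfold scMeasure
  split_ifs <;> infer_instance

/-- A finite measure equivalent to the sum of the diffuse parts of the measures `scMeasure N q 1`
with `q` rational. -/
noncomputable def driftMeasure (N : ℝ → ℝ → Measure (FiniteMeasure E)) : Measure ℝ :=
  (Measure.sum fun q : ℚ => (scMeasure N q fun _ => 1).restrict (jumpSet N)ᶜ).toFinite

instance (N : ℝ → ℝ → Measure (FiniteMeasure E)) : IsFiniteMeasure (driftMeasure N) := by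
  unfold driftMeasure
  infer_instance

/-- The density of the absolutely continuous part of `scMeasure N t f` with respect to
`driftMeasure N`. -/
noncomputable def scDensity (N : ℝ → ℝ → Measure (FiniteMeasure E)) (t : ℝ) (f : E → ℝ) (s : ℝ) :
    ℝ :=
  ((scMeasure N t f).rnDeriv (driftMeasure N) s).toReal

lemma ae_tendsto_div_driftMeasure (μ : Measure ℝ) [IsLocallyFiniteMeasure μ]
    (N : ℝ → ℝ → Measure (FiniteMeasure E)) :
    ∀ᵐ s ∂driftMeasure N, Tendsto (fun r => ((driftMeasure N).real (Metric.closedBall s r))⁻¹ *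
      μ.real (Metric.closedBall s r)) (𝓝[>] 0) (𝓝 (μ.rnDeriv (driftMeasure N) s).toReal) := by
  filter_upwards [Besicovitch.ae_tendsto_rnDeriv μ (driftMeasure N),
    Measure.rnDeriv_lt_top μ (driftMeasure N)] with s h1 h2
  refine ((ENNReal.tendsto_toReal h2.ne).comp h1).congr fun r => ?_
  rw [Function.comp_apply, ENNReal.toReal_div, div_eq_inv_mul]
  rfl

end Increments

/-- Symmetric intervals around `s` with endpoints off a countable set, shrinking to `s`. -/
lemma exists_seq_radius {T : Set ℝ} (hT : T.Countable) {s q : ℝ} (hsq : s < q) :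
    ∃ r : ℕ → ℝ, Tendsto r atTop (𝓝[>] 0) ∧
      ∀ n, 0 < r n ∧ s + r n < q ∧ s + r n ∉ T ∧ s - r n ∉ T := by
  have hd : Dense ((fun r => s + r) ⁻¹' T ∪ (fun r => s - r) ⁻¹' T)ᶜ :=
    ((hT.preimage (add_right_injective s)).union
      (hT.preimage sub_right_injective)).dense_compl ℝ
  have hex := fun n : ℕ => hd.exists_between
    (lt_min (show (0 : ℝ) < 1 / ((n : ℝ) + 1) by positivity) (sub_pos.2 hsq))
  choose r hrT hr using hex
  refine ⟨r, tendsto_nhdsWithin_iff.2 ⟨?_, .of_forall fun n => (hr n).1⟩, fun n => ?_⟩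
  · exact tendsto_of_tendsto_of_tendsto_of_le_of_le tendsto_const_nhds
      tendsto_one_div_add_atTop_nhds_zero_nat (fun n => (hr n).1.le)
      fun n => (hr n).2.le.trans (min_le_left _ _)
  · have h1 := (hr n).2.trans_le (min_le_right _ _)
    exact ⟨(hr n).1, by linarith, fun hc => hrT n (Or.inl hc), fun hc => hrT n (Or.inr hc)⟩

namespace IsProbSC

section Domination

variable {E : Type u} [TopologicalSpace E] [MeasurableSpace E]
  {Q : ℝ → ℝ → Kernel (FiniteMeasure E) (FiniteMeasure E)}
  {N : ℝ → ℝ → Measure (FiniteMeasure E)} {f g : E → ℝ} {q r t a b : ℝ}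

lemma scMeasure_eq (h : IsProbSC Q N) (hf : IsBPos f) :
    scMeasure N t f = lsMeasure (h.monotone_scFun hf (t := t)) :=
  dif_pos _

lemma scMeasure_mono (h : IsProbSC Q N) (hf : IsBPos f) (hg : IsBPos g) (hfg : ∀ x, f x ≤ g x) :
    scMeasure N t f ≤ scMeasure N t g := by
  rw [h.scMeasure_eq hf, h.scMeasure_eq hg]
  exact lsMeasure_mono _ _ (h.monotone_scFun_sub hf hg hfg)

lemma scMeasure_le_natCast_smul (h : IsProbSC Q N) (hf : IsBPos f) {n : ℕ} (hn : ∀ x, f x ≤ n) :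
    scMeasure N t f ≤ n • scMeasure N t fun _ => 1 := by
  have h1 := h.monotone_scFun (t := t) (f := fun _ => 1) (IsBPos.const zero_le_one)
  rw [h.scMeasure_eq hf, h.scMeasure_eq (IsBPos.const zero_le_one),
    ← lsMeasure_natCast_mul h1 n (h1.const_mul n.cast_nonneg)]
  exact lsMeasure_mono _ _ (h.monotone_natCast_mul_scFun_sub hf hn)

lemma scMeasure_restrict_Iio (h : IsProbSC Q N) (hqt : q ≤ t) (hf : IsBPos f) :
    (scMeasure N t f).restrict (Set.Iio q) =
      (scMeasure N q (cumulant Q q t f)).restrict (Set.Iio q) := by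
  rw [h.scMeasure_eq hf, h.scMeasure_eq (h.semigroup.isBPos_cumulant hqt hf)]
  exact lsMeasure_restrict_Iio_congr _ _ fun x hx => h.scFun_eq_add hx.le hqt hf

lemma scMeasure_Ioi (h : IsProbSC Q N) (hf : IsBPos f) : scMeasure N t f (Set.Ioi t) = 0 := by
  rw [h.scMeasure_eq hf]
  exact lsMeasure_Ioi_eq_zero _ fun x hx => by rw [h.scFun_of_ge hx hf, h.scFun_of_ge le_rfl hf]

/-- For measures of increments, shrinking test functions give vanishing measures of intervals. -/
lemma tendsto_scMeasure_Icc (h : IsProbSC Q N) {fs : ℕ → E → ℝ} (hfs : ∀ i, IsBPos (fs i))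
    (hanti : ∀ x, Antitone fun i => fs i x) (hlim : ∀ x, Tendsto (fun i => fs i x) atTop (𝓝 0)) :
    Tendsto (fun i => scMeasure N t (fs i) (Set.Icc a b)) atTop (𝓝 0) := by
  have hG : ∀ r, Tendsto (fun i => scFun N t (fs i) r) atTop (𝓝 0) := by
    intro r
    have := h.prob (min r t) t (min_le_right _ _)
    obtain ⟨m, -, hm⟩ := (hfs 0).exists_nat_bound
    have h1 := tendsto_laplace (F := N (min r t) t) (f := fun _ => 0) hfs (C := m)
      (fun n x => (hanti x n.zero_le).trans (hm x)) hlim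
    rw [laplace_zero] at h1
    have h2 := (Real.continuousAt_log one_ne_zero).tendsto.comp h1
    rw [Real.log_one] at h2
    exact h2.congr fun i => (log_laplace : _)
  have h3 := ENNReal.tendsto_ofReal ((hG (b + 1)).sub (hG (a - 1)))
  rw [sub_zero, ENNReal.ofReal_zero] at h3
  refine tendsto_of_tendsto_of_tendsto_of_le_of_le tendsto_const_nhds h3 (fun _ => zero_le) ?_
  intro i
  change scMeasure N t (fs i) (Set.Icc a b) ≤ _
  rw [h.scMeasure_eq (hfs i)]
  exact lsMeasure_Icc_le _ (by linarith) (by linarith)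

lemma driftMeasure_jumpSet (h : IsProbSC Q N) : driftMeasure N (jumpSet N) = 0 := by
  refine toFinite_absolutelyContinuous _ (Measure.sum_apply_eq_zero.2 fun q => ?_)
  rw [Measure.restrict_apply h.countable_jumpSet.measurableSet, Set.inter_compl_self,
    measure_empty]

lemma scDensity_ae_eq (h : IsProbSC Q N) (hqt : q ≤ t) (hf : IsBPos f) :
    ∀ᵐ s ∂driftMeasure N, s < q → scDensity N t f s = scDensity N q (cumulant Q q t f) s := by
  have h1 := Measure.rnDeriv_restrict (scMeasure N t f) (driftMeasure N)
    (measurableSet_Iio (a := q))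
  have h2 := Measure.rnDeriv_restrict (scMeasure N q (cumulant Q q t f)) (driftMeasure N)
    (measurableSet_Iio (a := q))
  rw [h.scMeasure_restrict_Iio hqt hf] at h1
  filter_upwards [h1, h2] with s hs1 hs2 hsq
  have hsq' : s ∈ Set.Iio q := hsq
  rw [hs1, Set.indicator_of_mem hsq', Set.indicator_of_mem hsq'] at hs2
  rw [scDensity, scDensity, hs2]

lemma ae_tendsto_scDensity (h : IsProbSC Q N) {fs : ℕ → E → ℝ} (hfs : ∀ i, IsBPos (fs i))
    (hanti : ∀ x, Antitone fun i => fs i x) (hlim : ∀ x, Tendsto (fun i => fs i x) atTop (𝓝 0))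
    (t : ℝ) : ∀ᵐ s ∂driftMeasure N, Tendsto (fun i => scDensity N t (fs i) s) atTop (𝓝 0) := by
  let d : ℕ → ℝ → ℝ≥0∞ := fun i => (scMeasure N t (fs i)).rnDeriv (driftMeasure N)
  have hd : ∀ᵐ s ∂driftMeasure N, Antitone fun i => d i s := by
    filter_upwards [ae_all_iff.2 fun i => Besicovitch.ae_tendsto_rnDeriv (scMeasure N t (fs i))
      (driftMeasure N)] with s hs
    refine fun i j hij => le_of_tendsto_of_tendsto' (hs j) (hs i) fun r => ?_
    exact ENNReal.div_le_div_right
      (h.scMeasure_mono (hfs j) (hfs i) (fun x => hanti x hij) _) _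
  have hinf : ∀ᵐ s ∂driftMeasure N, ⨅ i, d i s = 0 := by
    have h1 : ∀ n : ℕ, ∫⁻ s in Set.Icc (-n : ℝ) n, ⨅ i, d i s ∂driftMeasure N = 0 := by
      intro n
      refine le_antisymm (ge_of_tendsto'
        (h.tendsto_scMeasure_Icc (t := t) (a := -n) (b := n) hfs hanti hlim) fun i => ?_) zero_le
      exact (lintegral_mono fun s => iInf_le _ i).trans (Measure.setLIntegral_rnDeriv_le _)
    have h2 : ∀ᵐ s ∂driftMeasure N, ∀ n : ℕ, s ∈ Set.Icc (-n : ℝ) n → ⨅ i, d i s = 0 := by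
      refine ae_all_iff.2 fun n => (ae_restrict_iff' measurableSet_Icc).1 ?_
      exact (lintegral_eq_zero_iff (.iInf fun i => Measure.measurable_rnDeriv _ _)).1 (h1 n)
    filter_upwards [h2] with s hs
    obtain ⟨n, hn⟩ := exists_nat_ge |s|
    exact hs n (abs_le.1 hn)
  filter_upwards [hd, hinf] with s h1 h2
  have h3 := tendsto_atTop_iInf h1
  rw [h2] at h3
  exact (ENNReal.tendsto_toReal ENNReal.zero_ne_top).comp h3

/-- The measure of increments restricted to the jumps is the sum of its atoms, and each atom splits
into a right jump and a left jump. -/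
lemma scMeasure_Ioc_inter_jumpSet (h : IsProbSC Q N) (hf : IsBPos f) :
    scMeasure N t f (Set.Ioc r t ∩ jumpSet N) =
      ∑' s : ↥(Set.Ioc r t ∩ jumpSet N),
        ENNReal.ofReal (Function.rightLim (scFun N t f) s - scFun N t f s) +
      ∑' s : ↥(Set.Ioc r t ∩ jumpSet N),
        ENNReal.ofReal (scFun N t f s - Function.leftLim (scFun N t f) s) := by
  have hc : (Set.Ioc r t ∩ jumpSet N).Countable := h.countable_jumpSet.mono Set.inter_subset_right
  have := hc.to_subtype
  have hG := h.monotone_scFun hf (t := t)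
  have hU : scMeasure N t f (Set.Ioc r t ∩ jumpSet N) =
      ∑' s : ↥(Set.Ioc r t ∩ jumpSet N), scMeasure N t f {(s : ℝ)} := by
    rw [← measure_iUnion (fun a b hab => Set.disjoint_singleton.2 fun hc => hab (Subtype.ext hc))
      fun _ => measurableSet_singleton _, Set.iUnion_of_singleton_coe]
  rw [hU, ← ENNReal.tsum_add]
  refine tsum_congr fun s => ?_
  rw [h.scMeasure_eq hf, lsMeasure_singleton,
    ← ENNReal.ofReal_add (sub_nonneg.2 (hG.le_rightLim le_rfl))
      (sub_nonneg.2 (hG.leftLim_le le_rfl))]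
  congr 1
  ring

end Domination

section Density

variable {E : Type u} [TopologicalSpace E] [LusinTopologicalSpace E] [MeasurableSpace E]
  [BorelSpace E] {Q : ℝ → ℝ → Kernel (FiniteMeasure E) (FiniteMeasure E)}
  {N : ℝ → ℝ → Measure (FiniteMeasure E)} {f : E → ℝ} {q s t a b : ℝ}

lemma scMeasure_singleton (h : IsProbSC Q N) (hs : s ∉ jumpSet N) (hf : IsBPos f) :
    scMeasure N t f {s} = 0 := by
  rw [h.scMeasure_eq hf]
  exact lsMeasure_singleton_of_continuousAt _ (h.continuousAt_scFun hs t hf)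

lemma scMeasure_Icc (h : IsProbSC Q N) (ha : a ∉ jumpSet N) (hb : b ∉ jumpSet N) (hab : a ≤ b)
    (hbt : b ≤ t) (hf : IsBPos f) :
    scMeasure N t f (Set.Icc a b) = ENNReal.ofReal (lexp (N a b) (cumulant Q b t f)) := by
  rw [h.scMeasure_eq hf, lsMeasure_Icc_of_continuousAt _ (h.continuousAt_scFun ha t hf)
    (h.continuousAt_scFun hb t hf), h.scFun_sub hab hbt hf]

lemma driftMeasure_singleton (h : IsProbSC Q N) (s : ℝ) : driftMeasure N {s} = 0 := by
  by_cases hs : s ∈ jumpSet N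
  · exact measure_mono_null (Set.singleton_subset_iff.2 hs) h.driftMeasure_jumpSet
  · refine toFinite_absolutelyContinuous _ (Measure.sum_apply_eq_zero.2 fun q => ?_)
    exact nonpos_iff_eq_zero.1 ((Measure.restrict_apply_le _ _).trans
      (h.scMeasure_singleton hs (IsBPos.const zero_le_one)).le)

/-- The measure `scMeasure N t f` is dominated off the jumps: below a rational `q ≤ t` it coincides
with `scMeasure N q g` for some `g`, which is dominated by a multiple of `scMeasure N q 1`. -/
lemma restrict_absolutelyContinuous (h : IsProbSC Q N) (hf : IsBPos f) :
    (scMeasure N t f).restrict (jumpSet N)ᶜ ≪ driftMeasure N := by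
  have hT := h.countable_jumpSet.measurableSet
  refine Measure.AbsolutelyContinuous.trans ?_ (absolutelyContinuous_toFinite _)
  intro A hA
  rw [Measure.sum_apply_eq_zero] at hA
  rw [Measure.restrict_apply' hT.compl]
  have hq : ∀ (q : ℚ) (g : E → ℝ), IsBPos g → scMeasure N q g (A ∩ (jumpSet N)ᶜ) = 0 := by
    intro q g hg
    obtain ⟨n, -, hn⟩ := hg.exists_nat_bound
    have h1 := hA q
    rw [Measure.restrict_apply' hT.compl] at h1
    refine nonpos_iff_eq_zero.1 ((h.scMeasure_le_natCast_smul hg hn _).trans_eq ?_)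
    rw [Measure.smul_apply, h1, smul_zero]
  have hcover : A ∩ (jumpSet N)ᶜ ⊆ (⋃ q : {q : ℚ // (q : ℝ) < t},
      (A ∩ (jumpSet N)ᶜ) ∩ Set.Iio ((q : ℚ) : ℝ)) ∪ ({t} ∩ (jumpSet N)ᶜ) ∪ Set.Ioi t := by
    intro x hx
    rcases lt_trichotomy x t with hxt | rfl | hxt
    · obtain ⟨q, hxq, hqt⟩ := exists_rat_btwn hxt
      exact Or.inl (Or.inl (Set.mem_iUnion.2 ⟨⟨q, hqt⟩, hx, hxq⟩))
    · exact Or.inl (Or.inr ⟨rfl, hx.2⟩)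
    · exact Or.inr hxt
  refine measure_mono_null hcover (measure_union_null (measure_union_null
    (measure_iUnion_null fun q => ?_) ?_) (h.scMeasure_Ioi hf))
  · rw [← Measure.restrict_apply' measurableSet_Iio, h.scMeasure_restrict_Iio q.2.le hf]
    exact nonpos_iff_eq_zero.1 ((Measure.restrict_apply_le _ _).trans
      (hq _ _ (h.semigroup.isBPos_cumulant q.2.le hf)).le)
  · by_cases ht : t ∈ jumpSet N
    · rw [Set.singleton_inter_eq_empty.2 (by simpa using ht), measure_empty]
    · exact measure_mono_null Set.inter_subset_left (h.scMeasure_singleton ht hf)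

end Density

end IsProbSC

/-! ### Differentiation: the infinitely divisible entrance laws -/

namespace IsProbSC

section Differentiation

variable {E : Type u} [TopologicalSpace E] [LusinTopologicalSpace E] [MeasurableSpace E]
  [BorelSpace E] {Q : ℝ → ℝ → Kernel (FiniteMeasure E) (FiniteMeasure E)}
  {N : ℝ → ℝ → Measure (FiniteMeasure E)} {f : E → ℝ} {q s t : ℝ}

lemma tendsto_driftMeasure_closedBall (h : IsProbSC Q N) (s : ℝ) :
    Tendsto (fun r => (driftMeasure N).real (Metric.closedBall s r)) (𝓝[>] 0) (𝓝 0) := by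
  have h1 := (tendsto_measure_cthickening_of_isClosed (μ := driftMeasure N) (s := {s})
    ⟨1, one_pos, measure_ne_top _ _⟩ isClosed_singleton).mono_left
      (nhdsWithin_le_nhds (s := Set.Ioi 0))
  rw [h.driftMeasure_singleton] at h1
  refine ((ENNReal.tendsto_toReal ENNReal.zero_ne_top).comp h1).congr' ?_
  filter_upwards [self_mem_nhdsWithin] with r hr
  rw [Function.comp_apply, Metric.cthickening_singleton s (le_of_lt hr)]
  rfl

/-- Around almost every point, the laws `N_{s-r,s+r} Q_{s+r,q}`, raised to a convolution power of
order `c / ζ[s-r,s+r]` with `ζ` the dominating measure, have Laplace exponents converging to `c`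
times the density. -/
lemma ae_exists_tendsto_laplace (h : IsProbSC Q N) {ι : Type} [Countable ι] {fs : ι → E → ℝ}
    (hfs : ∀ i, IsBPos (fs i)) {c : ℝ} (hc : 0 ≤ c) (q : ℝ) :
    ∀ᵐ s ∂driftMeasure N, s < q → ∃ F : ℕ → Measure (FiniteMeasure E),
      (∀ n, IsProbabilityMeasure (F n)) ∧
      ∀ i, Tendsto (fun n => laplace (F n) (fs i)) atTop
        (𝓝 (Real.exp (-(c * scDensity N q (fs i) s)))) := by
  filter_upwards [ae_all_iff.2 fun i => ae_tendsto_div_driftMeasure (scMeasure N q (fs i)) N,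
    ae_tendsto_div_driftMeasure (driftMeasure N) N, Measure.rnDeriv_self (driftMeasure N),
    measure_eq_zero_iff_ae_notMem.1 h.driftMeasure_jumpSet] with s hs hself hone hsT hsq
  obtain ⟨r, hr, hrT⟩ := exists_seq_radius h.countable_jumpSet hsq
  rw [hone, ENNReal.toReal_one] at hself
  let z : ℕ → ℝ := fun n => (driftMeasure N).real (Metric.closedBall s (r n))
  have hz0 : Tendsto z atTop (𝓝[>] 0) := by
    refine tendsto_nhdsWithin_iff.2 ⟨(h.tendsto_driftMeasure_closedBall s).comp hr, ?_⟩
    -- the ratio for the dominating measure itself tends to `1`, so its balls have positive measure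
    filter_upwards [(hself.comp hr).eventually_ne one_ne_zero] with n hn
    exact lt_of_le_of_ne measureReal_nonneg (right_ne_zero_of_mul hn).symm
  have hzinv : Tendsto (fun n => (z n)⁻¹) atTop atTop := tendsto_inv_nhdsGT_zero.comp hz0
  let L : ℕ → Measure (FiniteMeasure E) := fun n => Q (s + r n) q ∘ₘ N (s - r n) (s + r n)
  have hle : ∀ n, s - r n ≤ s + r n := fun n => by linarith [(hrT n).1]
  have hN : ∀ n, IsProbabilityMeasure (N (s - r n) (s + r n)) := fun n => h.prob _ _ (hle n)
  have hL : ∀ n, IsProbabilityMeasure (L n) := fun n =>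
    h.semigroup.isProbabilityMeasure_comp (hrT n).2.1.le _
  refine ⟨fun n => convPow (L n) ⌊c * (z n)⁻¹⌋₊, fun n => inferInstance, fun i => ?_⟩
  have hlexp : ∀ n,
      lexp (L n) (fs i) = (scMeasure N q (fs i)).real (Metric.closedBall s (r n)) := by
    intro n
    obtain ⟨-, h2, h3, h4⟩ := hrT n
    have hV := h.semigroup.isBPos_cumulant h2.le (hfs i)
    rw [measureReal_def, Real.closedBall_eq_Icc, h.scMeasure_Icc h4 h3 (hle n) h2.le (hfs i),
      ENNReal.toReal_ofReal (lexp_nonneg hV), h.semigroup.lexp_comp h2.le (hfs i)]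
  have hlim : Tendsto (fun n => (⌊c * (z n)⁻¹⌋₊ : ℝ) * lexp (L n) (fs i)) atTop
      (𝓝 (c * scDensity N q (fs i) s)) := by
    refine (((tendsto_nat_floor_mul_div_atTop hc).comp hzinv).mul ((hs i).comp hr)).congr' ?_
    filter_upwards [(tendsto_nhdsWithin_iff.1 hz0).2] with n hn
    have hn' : z n ≠ 0 := ne_of_gt hn
    rw [Function.comp_apply, Function.comp_apply, hlexp n]
    change (⌊c * (z n)⁻¹⌋₊ : ℝ) / (z n)⁻¹ * ((z n)⁻¹ * _) = _
    field_simp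
  refine ((Real.continuous_exp.tendsto _).comp hlim.neg).congr fun n => ?_
  rw [Function.comp_apply, ← lexp_convPow (hfs i), exp_neg_lexp (hfs i)]

lemma isLaplaceLimit_scDensity (h : IsProbSC Q N) {c : ℝ} (hc : 0 ≤ c) (q : ℝ) :
    IsLaplaceLimit ((driftMeasure N).restrict (Set.Iio q))
      (fun f s => Real.exp (-(c * scDensity N q f s))) := by
  refine ⟨fun fs hfs => (ae_restrict_iff' measurableSet_Iio).2
    (h.ae_exists_tendsto_laplace hfs hc q), fun fs hfs hanti hlim => ae_restrict_of_ae ?_⟩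
  filter_upwards [h.ae_tendsto_scDensity hfs hanti hlim q] with s hs
  have h1 := (Real.continuous_exp.tendsto _).comp (hs.const_mul c).neg
  rwa [mul_zero, neg_zero, Real.exp_zero] at h1

/-- The fraction `1 / (k + 1)` of the density at time `q` is a Laplace exponent too, which gives the
convolution roots of order `k + 1`. -/
lemma exists_root (h : IsProbSC Q N) (q : ℝ) (k : ℕ) :
    ∃ K : ℝ → Measure (FiniteMeasure E), (∀ s, IsProbabilityMeasure (K s)) ∧
      ∀ f, IsBPos f → ∀ᵐ s ∂driftMeasure N, s < q →
        lexp (K s) f = ((k : ℝ) + 1)⁻¹ * scDensity N q f s := by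
  obtain ⟨K, hK, hKl⟩ := (h.isLaplaceLimit_scDensity (c := ((k : ℝ) + 1)⁻¹)
    (by positivity) q).exists_laplace_eq
  refine ⟨K, hK, fun f hf => ?_⟩
  filter_upwards [(ae_restrict_iff' measurableSet_Iio).1 (hKl f hf)] with s hs hsq
  rw [lexp, hs hsq, Real.log_exp, neg_neg]

lemma _root_.MBProcess.IsMBSemigroup.comp_convPow (hQ : IsMBSemigroup Q) (hst : s ≤ t)
    (F : Measure (FiniteMeasure E)) [IsProbabilityMeasure F] (n : ℕ) :
    Q s t ∘ₘ convPow F n = convPow (Q s t ∘ₘ F) n := by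
  have := countablyGenerated_of_lusin E
  have := hQ.isProbabilityMeasure_comp hst F
  have := hQ.isProbabilityMeasure_comp hst (convPow F n)
  refine laplace_ext fun f hf => ?_
  rw [← exp_neg_lexp hf, ← exp_neg_lexp hf, hQ.lexp_comp hst hf, lexp_convPow hf,
    lexp_convPow (hQ.isBPos_cumulant hst hf), hQ.lexp_comp hst hf]

/-- A consistent family of infinitely divisible laws at the rational times after `s` extends to an
infinitely divisible entrance law at `s`. -/
lemma _root_.MBProcess.IsMBSemigroup.exists_isInfDivProbEntranceLaw (hQ : IsMBSemigroup Q) {s : ℝ}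
    {ρ : ℚ → Measure (FiniteMeasure E)} (hρ : ∀ q : ℚ, s < q → IsProbabilityMeasure (ρ q))
    (hinf : ∀ q : ℚ, s < q → IsInfDiv (ρ q))
    (hcomp : ∀ q q' : ℚ, s < q → q ≤ q' → Q q q' ∘ₘ ρ q = ρ q') :
    ∃ K : ℝ → Measure (FiniteMeasure E), IsInfDivProbEntranceLaw Q s K ∧
      ∀ q : ℚ, s < q → K q = ρ q := by
  have hex : ∀ t, s < t → ∃ q : ℚ, s < q ∧ (q : ℝ) < t := fun t ht => exists_rat_btwn ht
  choose! q hsq hqt using hex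
  have hind : ∀ (t : ℝ) (p p' : ℚ), s < p → p ≤ p' → (p' : ℝ) ≤ t →
      Q p t ∘ₘ ρ p = Q p' t ∘ₘ ρ p' := by
    intro t p p' hsp hpp ht
    rw [← hcomp p p' hsp hpp, hQ.comp_comp (by exact_mod_cast hpp) ht]
  have hK : ∀ (t : ℝ) (p : ℚ), s < p → (p : ℝ) ≤ t → Q (q t) t ∘ₘ ρ (q t) = Q p t ∘ₘ ρ p := by
    intro t p hsp hpt
    have hst := hsp.trans_le hpt
    rcases le_total (q t) p with hle | hle
    · exact hind t _ _ (hsq t hst) hle hpt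
    · exact (hind t _ _ hsp hle (hqt t hst).le).symm
  refine ⟨fun t => Q (q t) t ∘ₘ ρ (q t), ⟨⟨fun t hst => ?_, fun r t hsr hrt => ?_⟩,
    fun t hst n hn => ?_⟩, fun p hsp => ?_⟩
  · have := hρ _ (hsq t hst)
    exact hQ.isProbabilityMeasure_comp (hqt t hst).le _
  · rw [hQ.comp_comp (hqt r hsr).le hrt.le, hK t (q r) (hsq r hsr) ((hqt r hsr).le.trans hrt.le)]
  · obtain ⟨σ, hσ, hσn⟩ := hinf _ (hsq t hst) n hn
    refine ⟨Q (q t) t ∘ₘ σ, hQ.isProbabilityMeasure_comp (hqt t hst).le _, ?_⟩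
    simp only [hσn]
    exact hQ.comp_convPow (hqt t hst).le _ _
  · exact (hK p p hsp le_rfl).trans (hQ.comp_self _)

/-- The diffuse part of the increments is given by infinitely divisible entrance laws. -/
theorem exists_infDivEntranceLaw (h : IsProbSC Q N) :
    ∃ K : ℝ → ℝ → Measure (FiniteMeasure E), (∀ s, IsInfDivProbEntranceLaw Q s (K s)) ∧
      ∀ t f, IsBPos f → ∀ᵐ s ∂driftMeasure N, s < t → lexp (K s t) f = scDensity N t f s := by
  have := countablyGenerated_of_lusin E
  choose ρ hρ hρl using fun (q : ℚ) (k : ℕ) => h.exists_root (q : ℝ) k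
  have hρ0 : ∀ (q : ℚ) f, IsBPos f →
      ∀ᵐ s : ℝ ∂driftMeasure N, s < q → lexp (ρ q 0 s) f = scDensity N q f s := by
    intro q f hf
    filter_upwards [hρl q 0 f hf] with s hs hsq
    rw [hs hsq, Nat.cast_zero, zero_add, inv_one, one_mul]
  obtain ⟨fs, hfs, hdet⟩ := exists_determining_family E
  have hroot : ∀ᵐ s : ℝ ∂driftMeasure N, ∀ (q : ℚ) (k : ℕ), s < q →
      ρ q 0 s = convPow (ρ q k s) (k + 1) := by
    refine ae_all_iff.2 fun q => ae_all_iff.2 fun k => ?_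
    filter_upwards [ae_all_iff.2 fun n => hρl q k _ (hfs n),
      ae_all_iff.2 fun n => hρ0 q _ (hfs n)] with s h1 h2 hsq
    have := hρ q k s
    have := hρ q 0 s
    refine hdet _ _ inferInstance inferInstance fun n => ?_
    rw [← exp_neg_lexp (hfs n), ← exp_neg_lexp (hfs n), lexp_convPow (hfs n), h1 n hsq, h2 n hsq]
    push_cast
    rw [mul_inv_cancel_left₀ (by positivity)]
  have hcomp : ∀ᵐ s : ℝ ∂driftMeasure N, ∀ (q q' : ℚ), s < q → q ≤ q' →
      Q q q' ∘ₘ ρ q 0 s = ρ q' 0 s := by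
    refine ae_all_iff.2 fun q => ae_all_iff.2 fun q' => ?_
    by_cases hqq : q ≤ q'
    swap
    · exact ae_of_all _ fun s _ hc => absurd hc hqq
    have hqq' : (q : ℝ) ≤ q' := by exact_mod_cast hqq
    have hV := fun n => h.semigroup.isBPos_cumulant hqq' (hfs n)
    filter_upwards [ae_all_iff.2 fun n => hρ0 q _ (hV n), ae_all_iff.2 fun n => hρ0 q' _ (hfs n),
      ae_all_iff.2 fun n => h.scDensity_ae_eq hqq' (hfs n)] with s h1 h2 h3 hsq _
    have := hρ q 0 s
    have := hρ q' 0 s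
    refine hdet _ _ (h.semigroup.isProbabilityMeasure_comp hqq' _) inferInstance fun n => ?_
    have := h.semigroup.isProbabilityMeasure_comp hqq' (ρ q 0 s)
    rw [← exp_neg_lexp (hfs n), ← exp_neg_lexp (hfs n), h.semigroup.lexp_comp hqq' (hfs n),
      h1 n hsq, h2 n (hsq.trans_le hqq'), h3 n hsq]
  have hex : ∀ s, ∃ K : ℝ → Measure (FiniteMeasure E), IsInfDivProbEntranceLaw Q s K ∧
      ((∀ (q : ℚ) (k : ℕ), s < q → ρ q 0 s = convPow (ρ q k s) (k + 1)) →
        (∀ (q q' : ℚ), s < q → q ≤ q' → Q q q' ∘ₘ ρ q 0 s = ρ q' 0 s) →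
        ∀ q : ℚ, s < q → K q = ρ q 0 s) := by
    intro s
    by_cases hs : (∀ (q : ℚ) (k : ℕ), s < q → ρ q 0 s = convPow (ρ q k s) (k + 1)) ∧
        ∀ (q q' : ℚ), s < q → q ≤ q' → Q q q' ∘ₘ ρ q 0 s = ρ q' 0 s
    · obtain ⟨K, hK, hKq⟩ := h.semigroup.exists_isInfDivProbEntranceLaw (s := s)
        (ρ := fun q => ρ q 0 s) (fun q _ => hρ q 0 s) (fun q hsq n hn => by
          obtain ⟨k, rfl⟩ := Nat.exists_eq_add_of_le' hn
          exact ⟨ρ q k s, hρ q k s, hs.1 q k hsq⟩) hs.2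
      exact ⟨K, hK, fun _ _ => hKq⟩
    · -- on the exceptional null set the entrance law is chosen to be trivial
      have hzero : ∀ f : E → ℝ, IsBPos f → lexp (Measure.dirac (0 : FiniteMeasure E)) f = 0 := by
        intro f hf
        simp [lexp, laplace_dirac _ hf]
      obtain ⟨K, hK, -⟩ := h.semigroup.exists_isInfDivProbEntranceLaw (s := s)
        (ρ := fun _ => Measure.dirac 0) (fun _ _ => inferInstance) (fun q _ n _ => by
          refine ⟨Measure.dirac 0, inferInstance, laplace_ext fun f hf => ?_⟩
          rw [← exp_neg_lexp hf, ← exp_neg_lexp hf, lexp_convPow hf, hzero f hf, mul_zero])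
        (fun q q' _ hqq => by
          have hqq' : (q : ℝ) ≤ q' := by exact_mod_cast hqq
          have := h.semigroup.isProbabilityMeasure_comp hqq' (Measure.dirac 0)
          refine laplace_ext fun f hf => ?_
          rw [← exp_neg_lexp hf, ← exp_neg_lexp hf, h.semigroup.lexp_comp hqq' hf, hzero f hf,
            hzero _ (h.semigroup.isBPos_cumulant hqq' hf)])
      exact ⟨K, hK, fun h1 h2 => absurd ⟨h1, h2⟩ hs⟩
  choose K hK hKq using hex
  refine ⟨K, hK, fun t f hf => ?_⟩
  have hV : ∀ᵐ s : ℝ ∂driftMeasure N, ∀ q : ℚ, (q : ℝ) ≤ t → s < q →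
      lexp (ρ q 0 s) (cumulant Q q t f) = scDensity N t f s := by
    refine ae_all_iff.2 fun q => ?_
    by_cases hqt : (q : ℝ) ≤ t
    · filter_upwards [hρ0 q _ (h.semigroup.isBPos_cumulant hqt hf), h.scDensity_ae_eq hqt hf]
        with s h1 h2 _ hsq
      rw [h1 hsq, h2 hsq]
    · exact ae_of_all _ fun s hc => absurd hc hqt
  filter_upwards [hroot, hcomp, hV] with s h1 h2 h3 hst
  obtain ⟨q, hsq, hqt⟩ := exists_rat_btwn hst
  rw [← (hK s).lexp_eq h.semigroup hsq hqt.le hf, hKq s h1 h2 q hsq, h3 q hqt.le hsq]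

end Differentiation

end IsProbSC

/-! ### The decomposition formula -/

lemma summable_and_integrable_of_ofReal_eq {α β S : Type*} [MeasurableSpace S] {μ : Measure S}
    {A : ℝ} {x : α → ℝ} {y : β → ℝ} {z : S → ℝ} (hA : 0 ≤ A) (hx : ∀ i, 0 ≤ x i)
    (hy : ∀ i, 0 ≤ y i) (hz : 0 ≤ᵐ[μ] z) (hzm : AEStronglyMeasurable z μ)
    (h : ENNReal.ofReal A = ∑' i, ENNReal.ofReal (x i) + ∑' i, ENNReal.ofReal (y i) +
      ∫⁻ s, ENNReal.ofReal (z s) ∂μ) :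
    Summable x ∧ Summable y ∧ Integrable z μ ∧ A = ∑' i, x i + ∑' i, y i + ∫ s, z s ∂μ := by
  have htop : ∑' i, ENNReal.ofReal (x i) + ∑' i, ENNReal.ofReal (y i) +
      ∫⁻ s, ENNReal.ofReal (z s) ∂μ ≠ ⊤ := h ▸ ENNReal.ofReal_ne_top
  obtain ⟨hxy, hzt⟩ := ENNReal.add_ne_top.1 htop
  obtain ⟨hxt, hyt⟩ := ENNReal.add_ne_top.1 hxy
  have hxs := ENNReal.summable_toReal hxt
  have hys := ENNReal.summable_toReal hyt
  simp only [ENNReal.toReal_ofReal (hx _), ENNReal.toReal_ofReal (hy _)] at hxs hys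
  refine ⟨hxs, hys, ⟨hzm, (hasFiniteIntegral_iff_ofReal hz).2 hzt.lt_top⟩, ?_⟩
  rw [integral_eq_lintegral_of_nonneg_ae hz hzm, ← ENNReal.toReal_ofReal hA, h,
    ENNReal.toReal_add hxy hzt, ENNReal.toReal_add hxt hyt,
    ENNReal.tsum_toReal_eq fun _ => ENNReal.ofReal_ne_top,
    ENNReal.tsum_toReal_eq fun _ => ENNReal.ofReal_ne_top]
  simp only [ENNReal.toReal_ofReal (hx _), ENNReal.toReal_ofReal (hy _)]

lemma tsum_indicator_Ico_eq {a : ℝ → ℝ≥0∞} {T : Set ℝ} {r t : ℝ} (hrt : r ≤ t)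
    (ha : ∀ s ∉ T, a s = 0) (hat : a t = 0) :
    ∑' s, (Set.Ico r t ∩ T).indicator a s = a r + ∑' s, (Set.Ioc r t ∩ T).indicator a s := by
  have h1 : ∀ s, (Set.Ico r t ∩ T).indicator a s =
      ({r} : Set ℝ).indicator a s + (Set.Ioc r t ∩ T).indicator a s := by
    intro s
    by_cases hs : a s = 0
    · simp [Set.indicator, hs]
    have hsT : s ∈ T := by_contra fun hc => hs (ha s hc)
    have hst : s ≠ t := fun hc => hs (hc ▸ hat)
    rcases lt_trichotomy s r with hsr | rfl | hsr
    · simp [Set.indicator, hsr.ne, hsr.not_ge, hsr.le.not_gt]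
    · simp [Set.indicator, hsT, lt_of_le_of_ne hrt hst]
    · rcases lt_or_gt_of_ne hst with hst' | hst'
      · simp [Set.indicator, hsT, hsr, hsr.le, hsr.ne', hst', hst'.le]
      · simp [Set.indicator, hsr.ne', hst'.not_ge, hst'.le.not_gt]
  rw [tsum_congr h1, ENNReal.tsum_add, tsum_eq_single r fun s hs => by simp [hs]]
  simp

namespace IsProbSC

section Formula

variable {E : Type u} [TopologicalSpace E] [LusinTopologicalSpace E] [MeasurableSpace E]
  [BorelSpace E] {Q : ℝ → ℝ → Kernel (FiniteMeasure E) (FiniteMeasure E)}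
  {N : ℝ → ℝ → Measure (FiniteMeasure E)} {f : E → ℝ} {r t : ℝ}

/-- Off the jumps, the measure of increments is the integral of its density. -/
lemma scMeasure_Ioc_diff_jumpSet (h : IsProbSC Q N) (hf : IsBPos f) :
    scMeasure N t f (Set.Ioc r t \ jumpSet N) =
      ∫⁻ s in Set.Ioo r t, ENNReal.ofReal (scDensity N t f s) ∂driftMeasure N := by
  have hT := h.countable_jumpSet.measurableSet
  have : NullSingletonClass (driftMeasure N) := ⟨h.driftMeasure_singleton⟩
  rw [Set.sdiff_eq, ← Measure.restrict_apply' hT.compl,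
    ← Measure.withDensity_rnDeriv_eq _ _ (h.restrict_absolutelyContinuous hf),
    withDensity_apply _ measurableSet_Ioc, setLIntegral_congr Ioo_ae_eq_Ioc.symm]
  refine lintegral_congr_ae (ae_restrict_of_ae ?_)
  filter_upwards [Measure.rnDeriv_restrict (scMeasure N t f) (driftMeasure N) hT.compl,
    Measure.rnDeriv_lt_top (scMeasure N t f) (driftMeasure N),
    measure_eq_zero_iff_ae_notMem.1 h.driftMeasure_jumpSet] with s h1 h2 h3
  rw [h1, Set.indicator_of_mem h3, scDensity, ENNReal.ofReal_toReal h2.ne]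

lemma ofReal_lexp_eq (h : IsProbSC Q N) (hrt : r ≤ t) (hf : IsBPos f) :
    ENNReal.ofReal (lexp (N r t) f) =
      ∑' s : ↥(Set.Ico r t ∩ jumpSet N),
        ENNReal.ofReal (Function.rightLim (scFun N t f) s - scFun N t f s) +
      ∑' s : ↥(Set.Ioc r t ∩ jumpSet N),
        ENNReal.ofReal (scFun N t f s - Function.leftLim (scFun N t f) s) +
      ∫⁻ s in Set.Ioo r t, ENNReal.ofReal (scDensity N t f s) ∂driftMeasure N := by
  have hG := h.monotone_scFun hf (t := t)
  have h1 : lexp (N r t) f = (Function.rightLim (scFun N t f) r - scFun N t f r) +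
      (Function.rightLim (scFun N t f) t - Function.rightLim (scFun N t f) r) := by
    rw [h.rightLim_scFun_self hf, scFun_of_le hrt]
    ring
  rw [h1, ENNReal.ofReal_add (sub_nonneg.2 (hG.le_rightLim le_rfl))
    (sub_nonneg.2 (hG.rightLim hrt)), ← lsMeasure_Ioc hG, ← h.scMeasure_eq hf,
    ← measure_inter_add_sdiff _ h.countable_jumpSet.measurableSet,
    h.scMeasure_Ioc_inter_jumpSet hf, h.scMeasure_Ioc_diff_jumpSet hf,
    tsum_subtype (Set.Ico r t ∩ jumpSet N)
      fun s => ENNReal.ofReal (Function.rightLim (scFun N t f) s - scFun N t f s),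
    tsum_subtype (Set.Ioc r t ∩ jumpSet N)
      fun s => ENNReal.ofReal (Function.rightLim (scFun N t f) s - scFun N t f s),
    tsum_indicator_Ico_eq hrt, add_assoc, add_assoc, add_assoc]
  · intro s hs
    rw [(h.continuousAt_scFun hs t hf).continuousWithinAt.rightLim_eq, sub_self,
      ENNReal.ofReal_zero]
  · rw [h.rightLim_scFun_self hf, h.scFun_of_ge le_rfl hf, sub_self, ENNReal.ofReal_zero]

end Formula

end IsProbSC

section Converse

variable {E : Type u} [TopologicalSpace E] [LusinTopologicalSpace E] [MeasurableSpace E]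
  [BorelSpace E] {Q : ℝ → ℝ → Kernel (FiniteMeasure E) (FiniteMeasure E)}
  {N : ℝ → ℝ → Measure (FiniteMeasure E)}

/-- The skew convolution equation can be checked on Laplace exponents. -/
lemma isSCSemigroup_of_log_laplace (hQ : IsMBSemigroup Q)
    (hN : ∀ r t, r ≤ t → IsProbabilityMeasure (N r t))
    (h : ∀ r s t, r ≤ s → s ≤ t → ∀ f : E → ℝ, IsBPos f → Real.log (laplace (N r t) f) =
      Real.log (laplace (N r s) (cumulant Q s t f)) + Real.log (laplace (N s t) f)) :
    IsSCSemigroup Q N := by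
  intro r s t hrs hst
  have := countablyGenerated_of_lusin E
  have := hN r s hrs
  have := hN s t hst
  have := hN r t (hrs.trans hst)
  have := hQ.isProbabilityMeasure_comp hst (N r s)
  refine laplace_ext fun f hf => ?_
  rw [← exp_neg_lexp hf, ← exp_neg_lexp hf, lexp_conv hf, hQ.lexp_comp hst hf, ← log_laplace,
    h r s t hrs hst f hf, log_laplace, log_laplace, neg_add]

/-- Splitting a sum over a set into sums over two pieces, along which the summand is known under
two different forms. -/
lemma tsum_eq_add_of_eq_union {S A B : Set ℝ} {x y : ℝ → ℝ} (hS : S = A ∪ B)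
    (hAB : Disjoint A B) (hx : Summable fun s : S => x s) (hxy : ∀ s ∈ A, x s = y s) :
    ∑' s : S, x s = ∑' s : A, y s + ∑' s : B, x s := by
  subst hS
  have hA : Summable fun s : A => x s :=
    hx.comp_injective (Set.inclusion_injective Set.subset_union_left)
  have hB : Summable fun s : B => x s :=
    hx.comp_injective (Set.inclusion_injective Set.subset_union_right)
  rw [Summable.tsum_union_disjoint (f := x) hAB hA hB]
  congr 1
  exact tsum_congr fun s => hxy s s.2

end Converse

end MBProcess

theorem theorem3p1 {E : Type*} [TopologicalSpace E] [LusinTopologicalSpace E]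
    [MeasurableSpace E] [BorelSpace E]
    (Q : ℝ → ℝ → Kernel (FiniteMeasure E) (FiniteMeasure E)) (hQ : IsMBSemigroup Q)
    (N : ℝ → ℝ → Measure (FiniteMeasure E))
    (hN : ∀ r t, r ≤ t → IsProbabilityMeasure (N r t)) :
    IsSCSemigroup Q N ↔
      ∃ (T₁ T₂ : Set ℝ) (ζ : Measure ℝ) (K₁ K₂ K₃ : ℝ → ℝ → Measure (FiniteMeasure E)),
        T₁.Countable ∧ T₂.Countable ∧
        IsLocallyFiniteMeasure ζ ∧ (∀ s, ζ {s} = 0) ∧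
        (∀ s ∈ T₁, IsProbEntranceLaw Q s (K₁ s)) ∧
        (∀ s ∈ T₂, IsClosedProbEntranceLaw Q s (K₂ s)) ∧
        (∀ s, IsInfDivProbEntranceLaw Q s (K₃ s)) ∧
        ∀ r t, r ≤ t → ∀ f : E → ℝ, IsBPos f →
          Summable (fun s : ↥(Set.Ico r t ∩ T₁) => Real.log (laplace (K₁ s t) f)) ∧
          Summable (fun s : ↥(Set.Ioc r t ∩ T₂) => Real.log (laplace (K₂ s t) f)) ∧
          IntegrableOn (fun s => Real.log (laplace (K₃ s t) f)) (Set.Ioo r t) ζ ∧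
          Real.log (laplace (N r t) f) =
            (∑' s : ↥(Set.Ico r t ∩ T₁), Real.log (laplace (K₁ s t) f)) +
            (∑' s : ↥(Set.Ioc r t ∩ T₂), Real.log (laplace (K₂ s t) f)) +
            ∫ s in Set.Ioo r t, Real.log (laplace (K₃ s t) f) ∂ζ := by
  constructor
  · intro hskew
    have h : IsProbSC Q N := ⟨hQ, hN, hskew⟩
    choose K₁ hK₁ hK₁l using h.exists_entranceLaw
    choose K₂ hK₂ hK₂l using h.exists_closedEntranceLaw
    obtain ⟨K₃, hK₃, hK₃l⟩ := h.exists_infDivEntranceLaw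
    refine ⟨jumpSet N, jumpSet N, driftMeasure N, K₁, K₂, K₃, h.countable_jumpSet,
      h.countable_jumpSet, inferInstance, h.driftMeasure_singleton, fun s _ => hK₁ s,
      fun s _ => hK₂ s, hK₃, fun r t hrt f hf => ?_⟩
    have := hN r t hrt
    have hz : ∀ᵐ s ∂(driftMeasure N).restrict (Set.Ioo r t),
        lexp (K₃ s t) f = scDensity N t f s := by
      filter_upwards [ae_restrict_of_ae (hK₃l t f hf), ae_restrict_mem measurableSet_Ioo]
        with s h1 h2 using h1 h2.2
    have hdm : Measurable (scDensity N t f) := (Measure.measurable_rnDeriv _ _).ennreal_toReal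
    have hsum := h.ofReal_lexp_eq hrt hf
    rw [tsum_congr fun s : ↥(Set.Ico r t ∩ jumpSet N) => by rw [← hK₁l s t s.2.1.2 f hf],
      tsum_congr fun s : ↥(Set.Ioc r t ∩ jumpSet N) => by rw [← hK₂l s t s.2.1.2 f hf],
      ← lintegral_congr_ae (hz.mono fun s hs => congrArg ENNReal.ofReal hs)] at hsum
    obtain ⟨h1, h2, h3, h4⟩ := summable_and_integrable_of_ofReal_eq (lexp_nonneg hf)
      (fun s : ↥(Set.Ico r t ∩ jumpSet N) => by
        have := (hK₁ s).prob t s.2.1.2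
        exact lexp_nonneg hf)
      (fun s : ↥(Set.Ioc r t ∩ jumpSet N) => by
        rw [hK₂l s t s.2.1.2 f hf]
        exact sub_nonneg.2 ((h.monotone_scFun hf).leftLim_le le_rfl))
      (hz.mono fun s hs => by
        rw [Pi.zero_apply, hs]
        exact ENNReal.toReal_nonneg)
      (hdm.aestronglyMeasurable.congr (hz.mono fun s hs => hs.symm)) hsum
    simp only [log_laplace]
    refine ⟨h1.neg, h2.neg, h3.neg, ?_⟩
    rw [tsum_neg, tsum_neg, integral_neg, h4]
    ring
  · rintro ⟨T₁, T₂, ζ, K₁, K₂, K₃, -, -, -, hζ, hK₁, hK₂, hK₃, hform⟩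
    have : NullSingletonClass ζ := ⟨hζ⟩
    refine isSCSemigroup_of_log_laplace hQ hN fun r s t hrs hst f hf => ?_
    obtain ⟨h1, h2, h3, h4⟩ := hform r t (hrs.trans hst) f hf
    obtain ⟨-, -, -, h4'⟩ := hform r s hrs _ (hQ.isBPos_cumulant hst hf)
    obtain ⟨-, -, -, h4''⟩ := hform s t hst f hf
    rw [h4, h4', h4'']
    rw [tsum_eq_add_of_eq_union (A := Set.Ico r s ∩ T₁) (B := Set.Ico s t ∩ T₁)
        (x := fun u => Real.log (laplace (K₁ u t) f))
        (y := fun u => Real.log (laplace (K₁ u s) (cumulant Q s t f)))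
        (by rw [← Set.union_inter_distrib_right, Set.Ico_union_Ico_eq_Ico hrs hst])
        ((Set.Ico_disjoint_Ico_same).mono Set.inter_subset_left Set.inter_subset_left) h1
        (fun u hu => by
          rw [log_laplace, log_laplace, (hK₁ u hu.2).lexp_eq hQ hu.1.2 hst hf]),
      tsum_eq_add_of_eq_union (A := Set.Ioc r s ∩ T₂) (B := Set.Ioc s t ∩ T₂)
        (x := fun u => Real.log (laplace (K₂ u t) f))
        (y := fun u => Real.log (laplace (K₂ u s) (cumulant Q s t f)))
        (by rw [← Set.union_inter_distrib_right, Set.Ioc_union_Ioc_eq_Ioc hrs hst])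
        ((Set.Ioc_disjoint_Ioc_of_le le_rfl).mono Set.inter_subset_left Set.inter_subset_left) h2
        (fun u hu => by
          rw [log_laplace, log_laplace, (hK₂ u hu.2).lexp_eq hQ hu.1.2 hst hf])]
    have hint : ∫ u in Set.Ioo r t, Real.log (laplace (K₃ u t) f) ∂ζ =
        ∫ u in Set.Ioo r s, Real.log (laplace (K₃ u s) (cumulant Q s t f)) ∂ζ +
          ∫ u in Set.Ioo s t, Real.log (laplace (K₃ u t) f) ∂ζ := by
      rw [setIntegral_congr_fun (s := Set.Ioo r s)
        (g := fun u => Real.log (laplace (K₃ u t) f)) measurableSet_Ioo fun u hu => by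
          simp only [log_laplace, (hK₃ u).lexp_eq hQ hu.2 hst hf]]
      rw [← integrableOn_Ioc_iff_integrableOn_Ioo] at h3
      simp only [← integral_Ioc_eq_integral_Ioo]
      rw [← setIntegral_union (Set.Ioc_disjoint_Ioc_of_le le_rfl) measurableSet_Ioc
        (h3.mono_set (Set.Ioc_subset_Ioc_right hst)) (h3.mono_set (Set.Ioc_subset_Ioc_left hrs)),
        Set.Ioc_union_Ioc_eq_Ioc hrs hst]
    rw [hint]
    ring
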